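/- Let $\mathbb{K}$ be a field and let $S=\mathbb{K}[x_1,\dots,x_n]$ with its standard $\mathbb{Z}^n$-grading. For a finitely generated $\mathbb{Z}^n$-graded $S$-module $M$, a homogeneous element $u\in M$ and $Z\subseteq\{x_1,\dots,x_n\}$, the $\mathbb{K}$-subspace $u\mathbb{K}[Z]=\{uf : f\in\mathbb{K}[Z]\}$ of $M$ is called a Stanley space of dimension $|Z|$ if it is a free $\mathbb{K}[Z]$-module with basis $u$. A Stanley decomposition of $M$ is a decomposition of $M$ as a finite direct sum of Stanley spaces. For $M\neq 0$, the Stanley depth $\mathrm{sdepth}(M)$ is the maximum, over all Stanley decompositions $\mathcal{D}$ of $M$, of the minimum dimension of a Stanley space in $\mathcal{D}$. Over the polynomial ring $S'$ in a subset of the variables, the Stanley depth is defined in the same way and denoted by $\mathrm{sdepth}_{S'}$. Let $G$ be a finite simple graph with vertex set $\{v_1,\dots,v_n\}$. Its edge ideal $I(G)$ is the ideal of $S$ generated by all $x_ix_j$ such that $\{v_i,v_j\}$ is an edge of $G$; the edge ideal of a subgraph is taken in the polynomial ring in the variables of the vertices of that subgraph. **Theorem.** Let $H$ be a connected component of $G$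 with at least one edge, and let $h$ be the number of bipartite connected components of the graph $G\setminus V(H)$ obtained from $G$ by removing the vertices of $H$ (an isolated vertex counts as a bipartite component). Then for every integer $k\geq 1$, $$\mathrm{sdepth}(I(G)^k)\ \geq\ \min_{1\leq l\leq k}\mathrm{sdepth}_{S'}(I(H)^l)+h,$$ where $S'=\mathbb{K}[x_i\mid v_i\in V(H)]$. -/

import Mathlib

namespace StanleyDepth

open MvPolynomial

/-- The Stanley space `u K[Z]`: the `K`-subspace of the module `M` over `S = K[x_i | i ∈ σ]`
consisting of all elements `f • u` with `f ∈ K[Z]`, where `Z` is a set of variables and `K[Z]` is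
viewed as a subring of `S`. -/
noncomputable def stanleySpace {σ K M : Type*} [Field K] [AddCommGroup M] [Module K M]
    [Module (MvPolynomial σ K) M] [IsScalarTower K (MvPolynomial σ K) M]
    (u : M) (Z : Finset σ) : Submodule K M :=
  (Subalgebra.toSubmodule (supported K (Z : Set σ))).map
    ((LinearMap.toSpanSingleton (MvPolynomial σ K) M u).restrictScalars K)

/-- `M = ⨁ i, u i K[Z i]` is a (finite) Stanley decomposition of the `ℤ^σ`-graded module `M` over
`S = K[x_i | i ∈ σ]`, the component of `M` of degree `a` being `ℳ a`. -/
structure IsStanleyDecomposition {σ K M : Type*} [Field K] [AddCommGroup M] [Module K M]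
    [Module (MvPolynomial σ K) M] [IsScalarTower K (MvPolynomial σ K) M]
    (ℳ : (σ →₀ ℤ) → Submodule K M) {r : ℕ} (u : Fin r → M) (Z : Fin r → Finset σ) : Prop where
  /-- every generator is a homogeneous element of `M` -/
  homogeneous : ∀ i, ∃ a, u i ∈ ℳ a
  /-- `u i K[Z i]` is a free `K[Z i]`-module with basis `u i` -/
  free : ∀ i, ∀ f ∈ supported K (Z i : Set σ), f • u i = 0 → f = 0
  /-- `M` is the direct sum of the Stanley spaces -/
  isInternal : DirectSum.IsInternal fun i => stanleySpace (K := K) (u i) (Z i)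

/-- The Stanley depth of the `ℤ^σ`-graded module `M` over `S = K[x_i | i ∈ σ]` with graded
components `ℳ a`: the largest value, over all Stanley decompositions, of the smallest dimension
`|Z i|` of a Stanley space in the decomposition. As usual, it is `⊤` for the zero module (which has
the empty decomposition); if `σ` is finite and `M ≠ 0`, the values are at most `|σ|`, so that the
supremum is a maximum. -/
noncomputable def sdepth {σ K M : Type*} [Field K] [AddCommGroup M] [Module K M]
    [Module (MvPolynomial σ K) M] [IsScalarTower K (MvPolynomial σ K) M]
    (ℳ : (σ →₀ ℤ) → Submodule K M) : ℕ∞ :=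
  ⨆ (r : ℕ) (u : Fin r → M) (Z : Fin r → Finset σ) (_ : IsStanleyDecomposition ℳ u Z),
    ⨅ i, ((Z i).card : ℕ∞)

/-- The component of multidegree `a ∈ ℤ^σ` of an ideal `I` of `S = K[x_i | i ∈ σ]`, where `S` has
the standard `ℤ^σ`-grading, in which `x_i` has degree the `i`-th unit vector. -/
noncomputable def idealComponent {σ K : Type*} [Field K] (I : Ideal (MvPolynomial σ K))
    (a : σ →₀ ℤ) : Submodule K I :=
  (weightedHomogeneousSubmodule K (fun i : σ => Finsupp.single i (1 : ℤ)) a).comap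
    ((Submodule.subtype I).restrictScalars K)

/-- The Stanley depth of an ideal of the polynomial ring (meant for monomial ideals), regarded as a
`ℤ^σ`-graded module over this ring. -/
noncomputable def idealSdepth {σ K : Type*} [Field K] (I : Ideal (MvPolynomial σ K)) : ℕ∞ :=
  sdepth (idealComponent I)

/-- The edge ideal of a graph, in the polynomial ring whose variables are the vertices. -/
noncomputable def edgeIdeal {V : Type*} (K : Type*) [Field K] (G : SimpleGraph V) :
    Ideal (MvPolynomial V K) :=
  Ideal.span {p | ∃ v w, G.Adj v w ∧ p = X v * X w}

/-- The number of bipartite connected components of a (finite) graph. An isolated vertex is a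
bipartite component. -/
noncomputable def numBipartiteComponents {V : Type*} (G : SimpleGraph V) : ℕ :=
  Set.ncard {D : G.ConnectedComponent | D.toSimpleGraph.IsBipartite}

end StanleyDepth

/-! For a monomial ideal, multigraded Stanley decompositions are the same as finite partitions of
its set of exponent vectors into boxes (`le_idealSdepth_of_hasStanleyPartition`,
`hasStanleyPartition_of_le_idealSdepth`), so everything takes place in `V →₀ ℕ`. Membership of `x^m`
in the powers of an edge ideal is recorded by `order`, the largest number of edges that can be
packed below `m`; its superlevel sets are the powers, its level sets the quotients of consecutive
powers.

If no edge joins `A` to `B`, the order of `a + b` is the sum of the two orders. Hence the `k`-th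
power over `A ∪ B` is the disjoint union, over `i ≤ k`, of the part of order exactly `i` on `A` (at
least `k` when `i = k`) times the power `k - i` on `B`. Products of boxes add dimensions
(`hasStanleyPartition_superlevel_union`). Here `B` is `V(H)` and `A` its complement.

It remains to gain one dimension for each bipartite component outside `H`. By Kőnig duality the
order of `m` is the least weight of a vertex cover, and an optimal cover can be chosen to miss some
vertex `v`; multiplying by powers of `x_v` then keeps the order (`exists_order_add_single_eq`). So
every monomial of a level set has a free direction, which suffices for a partition into boxes of
positive dimension (`hasStanleyPartition_one_of_exists_direction`). -/

namespace StanleyDepth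

open MvPolynomial
open scoped Pointwise

/-! ### Partitions of sets of exponent vectors into boxes. -/

/-- The exponent vectors of the monomials in the Stanley space `x^u K[Z]`. -/
def box {V : Type*} (u : V →₀ ℕ) (Z : Finset V) : Set (V →₀ ℕ) :=
  {m | u ≤ m ∧ ∀ v ∉ Z, m v = u v}

lemma self_mem_box {V : Type*} (u : V →₀ ℕ) (Z : Finset V) : u ∈ box u Z :=
  ⟨le_rfl, fun _ _ => rfl⟩

lemma add_single_mem_box {V : Type*} (u : V →₀ ℕ) {Z : Finset V} {z : V} (hz : z ∈ Z) (t : ℕ) :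
    u + Finsupp.single z t ∈ box u Z := by
  refine ⟨le_self_add, fun v hv => ?_⟩
  have : z ≠ v := by rintro rfl; exact hv hz
  simp [this]

/-- A partition of a set of exponent vectors into boxes. -/
structure IsStanleyPartition {V ι : Type*} (M : Set (V →₀ ℕ)) (u : ι → V →₀ ℕ)
    (Z : ι → Finset V) : Prop where
  subset : ∀ i, box (u i) (Z i) ⊆ M
  existsUnique : ∀ m ∈ M, ∃! i, m ∈ box (u i) (Z i)

/-- The set `M` has a finite partition into boxes of dimension at least `d`. -/
def HasStanleyPartition {V : Type*} (M : Set (V →₀ ℕ)) (d : ℕ) : Prop :=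
  ∃ (r : ℕ) (u : Fin r → V →₀ ℕ) (Z : Fin r → Finset V),
    IsStanleyPartition M u Z ∧ ∀ i, d ≤ (Z i).card

lemma IsStanleyPartition.hasStanleyPartition {V ι : Type*} [Finite ι] {M : Set (V →₀ ℕ)}
    {u : ι → V →₀ ℕ} {Z : ι → Finset V} (h : IsStanleyPartition M u Z) {d : ℕ}
    (hd : ∀ i, d ≤ (Z i).card) : HasStanleyPartition M d := by
  obtain ⟨r, ⟨e⟩⟩ := Finite.exists_equiv_fin ι
  refine ⟨r, u ∘ e.symm, Z ∘ e.symm, ⟨fun i => h.subset _, fun m hm => ?_⟩, fun i => hd _⟩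
  obtain ⟨i, hi, hu⟩ := h.existsUnique m hm
  refine ⟨e i, by simpa using hi, fun j hj => ?_⟩
  rw [← hu _ hj, e.apply_symm_apply]

lemma HasStanleyPartition.mono {V : Type*} {M : Set (V →₀ ℕ)} {d d' : ℕ}
    (h : HasStanleyPartition M d) (hd : d' ≤ d) : HasStanleyPartition M d' := by
  obtain ⟨r, u, Z, h, h'⟩ := h
  exact ⟨r, u, Z, h, fun i => hd.trans (h' i)⟩

lemma HasStanleyPartition.le_card {V : Type*} {M : Set (V →₀ ℕ)} {d : ℕ}
    (h : HasStanleyPartition M d) (hM : M.Nonempty) : ∃ Z : Finset V, d ≤ Z.card := by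
  obtain ⟨r, u, Z, h, h'⟩ := h
  obtain ⟨m, hm⟩ := hM
  obtain ⟨i, -⟩ := h.existsUnique m hm
  exact ⟨_, h' i⟩

lemma HasStanleyPartition.iUnion {V κ : Type*} [Finite κ] {M : κ → Set (V →₀ ℕ)} {d : ℕ}
    (h : ∀ j, HasStanleyPartition (M j) d)
    (hdisj : ∀ i j m, m ∈ M i → m ∈ M j → i = j) : HasStanleyPartition (⋃ j, M j) d := by
  choose r u Z h h' using h
  refine IsStanleyPartition.hasStanleyPartition (ι := Σ j, Fin (r j)) (u := fun i => u i.1 i.2)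
    (Z := fun i => Z i.1 i.2) ⟨?_, ?_⟩ fun i => h' _ _
  · exact fun i => ((h i.1).subset i.2).trans (Set.subset_iUnion M i.1)
  · intro m hm
    obtain ⟨j, hj⟩ := Set.mem_iUnion.1 hm
    obtain ⟨i, hi, hu⟩ := (h j).existsUnique m hj
    refine ⟨⟨j, i⟩, hi, ?_⟩
    rintro ⟨j', i'⟩ hi'
    obtain rfl := hdisj j' j m ((h j').subset i' hi') hj
    rw [hu i' hi']

/-! ### Products over disjoint sets of variables. -/

/-- The exponent vectors of the monomials in the variables from `A`. -/
def supportedOn {V : Type*} (A : Set V) : Set (V →₀ ℕ) := {m | ∀ v ∉ A, m v = 0}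

lemma IsStanleyPartition.subset_of_supportedOn {V ι : Type*} {M : Set (V →₀ ℕ)}
    {u : ι → V →₀ ℕ} {Z : ι → Finset V} (h : IsStanleyPartition M u Z) {A : Set V}
    (hM : M ⊆ supportedOn A) (i : ι) : ∀ z ∈ Z i, z ∈ A := by
  intro z hz
  by_contra hzA
  have := hM (h.subset i (add_single_mem_box (u i) hz 1)) z hzA
  simp at this

lemma exists_add_eq_of_supportedOn_union {V : Type*} {A B : Set V} (hAB : Disjoint A B)
    {m : V →₀ ℕ} (hm : m ∈ supportedOn (A ∪ B)) :
    ∃ a ∈ supportedOn A, ∃ b ∈ supportedOn B, a + b = m := by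
  classical
  refine ⟨m.filter (· ∈ A), fun v hv => by simp [hv], m.filter (· ∈ B),
    fun v hv => by simp [hv], ?_⟩
  ext v
  have := hm v
  by_cases hA : v ∈ A
  · have hB : v ∉ B := Set.disjoint_left.1 hAB hA
    simp [hA, hB]
  · by_cases hB : v ∈ B
    · simp [hA, hB]
    · simp [hA, hB, hm v (by simp [hA, hB])]

lemma add_mem_supportedOn {V : Type*} {A B : Set V} {a b : V →₀ ℕ} (ha : a ∈ supportedOn A)
    (hb : b ∈ supportedOn B) : a + b ∈ supportedOn (A ∪ B) := by
  intro v hv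
  simp only [Set.mem_union, not_or] at hv
  simp [ha v hv.1, hb v hv.2]

lemma add_le_add_iff_of_supportedOn {V : Type*} {A B : Set V} (hAB : Disjoint A B)
    {a a' b b' : V →₀ ℕ} (ha : a ∈ supportedOn A) (ha' : a' ∈ supportedOn A)
    (hb : b ∈ supportedOn B) (hb' : b' ∈ supportedOn B) :
    a + b ≤ a' + b' ↔ a ≤ a' ∧ b ≤ b' := by
  refine ⟨fun h => ⟨fun v => ?_, fun v => ?_⟩, fun h => add_le_add h.1 h.2⟩
  · have := h v
    by_cases hA : v ∈ A
    · have hB : v ∉ B := Set.disjoint_left.1 hAB hA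
      simpa [hb v hB, hb' v hB] using this
    · simp [ha v hA]
  · have := h v
    by_cases hB : v ∈ B
    · have hA : v ∉ A := Set.disjoint_right.1 hAB hB
      simpa [ha v hA, ha' v hA] using this
    · simp [hb v hB]

lemma add_eq_add_iff_of_supportedOn {V : Type*} {A B : Set V} (hAB : Disjoint A B)
    {a a' b b' : V →₀ ℕ} (ha : a ∈ supportedOn A) (ha' : a' ∈ supportedOn A)
    (hb : b ∈ supportedOn B) (hb' : b' ∈ supportedOn B) :
    a + b = a' + b' ↔ a = a' ∧ b = b' := by
  simp only [le_antisymm_iff, add_le_add_iff_of_supportedOn hAB ha ha' hb hb',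
    add_le_add_iff_of_supportedOn hAB ha' ha hb' hb]
  tauto

lemma add_mem_box_iff {V : Type*} [DecidableEq V] {A B : Set V} (hAB : Disjoint A B)
    {a b u u' : V →₀ ℕ} {Z Z' : Finset V}
    (ha : a ∈ supportedOn A) (hb : b ∈ supportedOn B)
    (hu : u ∈ supportedOn A) (hu' : u' ∈ supportedOn B) (hZ : ∀ z ∈ Z, z ∈ A)
    (hZ' : ∀ z ∈ Z', z ∈ B) :
    a + b ∈ box (u + u') (Z ∪ Z') ↔ a ∈ box u Z ∧ b ∈ box u' Z' := by
  simp only [box, Set.mem_ofPred_eq, add_le_add_iff_of_supportedOn hAB hu ha hu' hb]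
  constructor
  · rintro ⟨⟨h1, h2⟩, h3⟩
    refine ⟨⟨h1, fun v hv => ?_⟩, ⟨h2, fun v hv => ?_⟩⟩
    · by_cases hA : v ∈ A
      · have hB : v ∉ B := Set.disjoint_left.1 hAB hA
        have := h3 v (by simp only [Finset.mem_union, not_or]; exact ⟨hv, fun h => hB (hZ' v h)⟩)
        simpa [hb v hB, hu' v hB] using this
      · rw [ha v hA, hu v hA]
    · by_cases hB : v ∈ B
      · have hA : v ∉ A := Set.disjoint_right.1 hAB hB
        have := h3 v (by simp only [Finset.mem_union, not_or]; exact ⟨fun h => hA (hZ v h), hv⟩)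
        simpa [ha v hA, hu v hA] using this
      · rw [hb v hB, hu' v hB]
  · rintro ⟨⟨h1, h2⟩, ⟨h3, h4⟩⟩
    refine ⟨⟨h1, h3⟩, fun v hv => ?_⟩
    simp only [Finset.mem_union, not_or] at hv
    simp [h2 v hv.1, h4 v hv.2]

/-- Pairwise sums of boxes are boxes, and their dimensions add because the free variables lie in the
disjoint sets `A` and `B`. -/
lemma HasStanleyPartition.add {V : Type*} {A B : Set V} (hAB : Disjoint A B)
    {M N : Set (V →₀ ℕ)} (hM : M ⊆ supportedOn A) (hN : N ⊆ supportedOn B) {d e : ℕ}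
    (h : HasStanleyPartition M d) (h' : HasStanleyPartition N e) :
    HasStanleyPartition (M + N) (d + e) := by
  classical
  obtain ⟨r, u, Z, h, hd⟩ := h
  obtain ⟨r', u', Z', h', hd'⟩ := h'
  have hu i : u i ∈ supportedOn A := hM (h.subset i (self_mem_box _ _))
  have hu' i : u' i ∈ supportedOn B := hN (h'.subset i (self_mem_box _ _))
  have hZ := h.subset_of_supportedOn hM
  have hZ' := h'.subset_of_supportedOn hN
  refine IsStanleyPartition.hasStanleyPartition (ι := Fin r × Fin r')
    (u := fun i => u i.1 + u' i.2) (Z := fun i => Z i.1 ∪ Z' i.2) ⟨?_, ?_⟩ ?_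
  · rintro ⟨i, j⟩ m hm
    have hmAB : m ∈ supportedOn (A ∪ B) := by
      intro v hv
      rw [hm.2 v]
      · exact add_mem_supportedOn (hu i) (hu' j) v hv
      · simp only [Finset.mem_union, not_or]
        exact ⟨fun h => hv (Or.inl (hZ i v h)), fun h => hv (Or.inr (hZ' j v h))⟩
    obtain ⟨a, ha, b, hb, rfl⟩ := exists_add_eq_of_supportedOn_union hAB hmAB
    rw [add_mem_box_iff hAB ha hb (hu i) (hu' j) (hZ i) (hZ' j)] at hm
    exact Set.add_mem_add (h.subset i hm.1) (h'.subset j hm.2)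
  · rintro m ⟨a, ha, b, hb, rfl⟩
    obtain ⟨i, hi, hiu⟩ := h.existsUnique a ha
    obtain ⟨j, hj, hju⟩ := h'.existsUnique b hb
    refine ⟨⟨i, j⟩, ?_, ?_⟩
    · exact (add_mem_box_iff hAB (hM ha) (hN hb) (hu i) (hu' j) (hZ i) (hZ' j)).2 ⟨hi, hj⟩
    · rintro ⟨i', j'⟩ hij
      have := (add_mem_box_iff hAB (hM ha) (hN hb) (hu i') (hu' j') (hZ i') (hZ' j')).1 hij
      rw [hiu i' this.1, hju j' this.2]
  · rintro ⟨i, j⟩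
    simp only
    rw [Finset.card_union_of_disjoint]
    · exact add_le_add (hd i) (hd' j)
    · exact Finset.disjoint_left.2 fun z hz hz' =>
        Set.disjoint_left.1 hAB (hZ i z hz) (hZ' j z hz')

/-! ### Box partitions of order-connected sets. -/

/-- Membership in an upper set only depends on the truncation of exponents at some bound. -/
lemma exists_forall_inf_mem_iff {V : Type*} [Finite V] {U : Set (V →₀ ℕ)} (hU : IsUpperSet U) :
    ∃ g : V →₀ ℕ, ∀ g' ≥ g, ∀ m, m ⊓ g' ∈ U ↔ m ∈ U := by
  -- Dickson's lemma; the bound is the join of the finitely many minimal elements.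
  have hfin : {m | Minimal (· ∈ U) m}.Finite :=
    WellQuasiOrderedLE.finite_of_isAntichain (setOfPred_minimal_antichain _)
  refine ⟨hfin.toFinset.sup id, fun g' hg' m => ⟨fun h => hU inf_le_left h, fun h => ?_⟩⟩
  obtain ⟨c, hcm, hc⟩ := exists_minimal_le_of_wellFoundedLT (· ∈ U) m h
  refine hU (le_inf hcm ?_) hc.prop
  exact (Finset.le_sup (f := id) (hfin.mem_toFinset.2 hc)).trans hg'

/-- An order-connected set is a difference of two upper sets, so membership depends only on `m ⊓ g`
for some `g`. The fibres of this truncation are boxes, whose free variables are those where the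
bound `g` is reached. -/
lemma hasStanleyPartition_of_ordConnected {V : Type*} [Finite V] {M : Set (V →₀ ℕ)}
    (hM : M.OrdConnected) : HasStanleyPartition M 0 := by
  classical
  have := Fintype.ofFinite V
  obtain ⟨g₁, h₁⟩ := exists_forall_inf_mem_iff (upperClosure M).upper
  have hW : IsUpperSet ((upperClosure M : Set (V →₀ ℕ)) \ M) := by
    rintro a b hab ⟨ha, ha'⟩
    refine ⟨(upperClosure M).upper hab ha, fun hb => ha' ?_⟩
    obtain ⟨c, hc, hca⟩ := mem_upperClosure.1 ha
    exact hM.out hc hb ⟨hca, hab⟩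
  obtain ⟨g₂, h₂⟩ := exists_forall_inf_mem_iff hW
  obtain ⟨g, hg⟩ : ∃ g, ∀ m, m ⊓ g ∈ M ↔ m ∈ M := by
    refine ⟨g₁ ⊔ g₂, fun m => ?_⟩
    have h1 := h₁ _ (le_sup_left (b := g₂)) m
    have h2 := h₂ _ (le_sup_right (a := g₁)) m
    have hsub : ∀ x ∈ M, x ∈ (upperClosure M : Set (V →₀ ℕ)) := fun x hx => subset_upperClosure hx
    simp only [Set.mem_sdiff] at h2
    have := hsub m
    have := hsub (m ⊓ (g₁ ⊔ g₂))
    tauto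
  have hbox : ∀ c ≤ g, ∀ m, m ∈ box c (Finset.univ.filter fun v => c v = g v) ↔ m ⊓ g = c := by
    intro c hc m
    simp only [box, Set.mem_ofPred_eq, Finset.mem_filter, Finset.mem_univ, true_and]
    constructor
    · rintro ⟨h1, h2⟩
      ext v
      have a1 := h1 v
      have a2 := h2 v
      have a3 := hc v
      simp only [Finsupp.inf_apply]
      by_cases hv : c v = g v
      · omega
      · have := a2 hv
        omega
    · rintro rfl
      refine ⟨inf_le_left, fun v hv => ?_⟩
      simp only [Finsupp.inf_apply] at hv ⊢
      omega
  refine IsStanleyPartition.hasStanleyPartition (ι := {c : Set.Iic g // (c : V →₀ ℕ) ∈ M})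
    (u := fun c => c.1.1) (Z := fun c => Finset.univ.filter fun v => c.1.1 v = g v)
    ⟨?_, ?_⟩ fun _ => Nat.zero_le _
  · rintro ⟨⟨c, hc⟩, hcM⟩ m hm
    have := (hbox c hc m).1 hm
    rw [← hg m, this]
    exact hcM
  · intro m hm
    refine ⟨⟨⟨m ⊓ g, Set.mem_Iic.2 inf_le_right⟩, (hg m).2 hm⟩, (hbox _ inf_le_right m).2 rfl, ?_⟩
    rintro ⟨⟨c, hc⟩, hcM⟩ h
    have := (hbox c hc m).1 h
    subst this
    rfl

/-- An order-connected set closed under adding `e_v` has a partition into boxes of positive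
dimension. -/
lemma hasStanleyPartition_one_of_add_single_mem {V : Type*} [Finite V] {M : Set (V →₀ ℕ)}
    (hM : M.OrdConnected) (v : V) (hv : ∀ m ∈ M, m + Finsupp.single v 1 ∈ M) :
    HasStanleyPartition M 1 := by
  classical
  -- `M` is the disjoint union of the rays in direction `v` starting at the points of `B`. So `v`
  -- can be added to the free variables of every box in a partition of `B`.
  let B : Set (V →₀ ℕ) := {m | m ∈ M ∧ ∀ m' ∈ M, m' + Finsupp.single v 1 ≠ m}
  have hB : B.OrdConnected := by
    refine ⟨fun a ha b hb m hm => ⟨hM.out ha.1 hb.1 hm, ?_⟩⟩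
    rintro m' hm' rfl
    obtain ⟨x, rfl⟩ := exists_add_of_le hm.2
    refine hb.2 (m' + x) (hM.out hm' hb.1 ⟨le_self_add, ?_⟩) (by abel)
    rw [add_right_comm]
    exact le_self_add
  obtain ⟨r, u, Z, h, -⟩ := hasStanleyPartition_of_ordConnected hB
  have hadd : ∀ t : ℕ, ∀ m ∈ M, m + Finsupp.single v t ∈ M := by
    intro t
    induction t with
    | zero => simp
    | succ t ih =>
      intro m hm
      rw [Finsupp.single_add, ← add_assoc]
      exact hv _ (ih m hm)
  have hbase : ∀ n : ℕ, ∀ m ∈ M, m v = n → ∃ b ∈ B, ∃ t, m = b + Finsupp.single v t := by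
    intro n
    induction n with
    | zero =>
      intro m hm hmv
      refine ⟨m, ⟨hm, ?_⟩, 0, by simp⟩
      rintro m' - rfl
      simp at hmv
    | succ n ih =>
      intro m hm hmv
      by_cases hmB : m ∈ B
      · exact ⟨m, hmB, 0, by simp⟩
      · have : ∃ m' ∈ M, m' + Finsupp.single v 1 = m := by
          by_contra! hcon
          exact hmB ⟨hm, hcon⟩
        obtain ⟨m', hm', rfl⟩ := this
        obtain ⟨b, hb, t, rfl⟩ := ih m' hm' (by simpa using hmv)
        exact ⟨b, hb, t + 1, by rw [Finsupp.single_add, add_assoc]⟩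
  have hvZ : ∀ i, v ∉ Z i := fun i hi =>
    (h.subset i (add_single_mem_box _ hi 1)).2 _ (h.subset i (self_mem_box _ _)).1 rfl
  have huniq : ∀ b ∈ B, ∀ b' ∈ B, ∀ t t' : ℕ, t ≤ t' →
      b + Finsupp.single v t = b' + Finsupp.single v t' → b = b' := by
    intro b hb b' hb' t t' htt' heq
    obtain ⟨s, rfl⟩ := exists_add_of_le htt'
    have hbb : b = b' + Finsupp.single v s := by
      rw [Finsupp.single_add, add_comm (Finsupp.single v t), ← add_assoc] at heq
      exact add_right_cancel heq
    cases s with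
    | zero => simpa using hbb
    | succ s =>
      exfalso
      refine hb.2 _ (hadd s b' hb'.1) ?_
      rw [hbb, Finsupp.single_add, add_assoc]
  have huniq' : ∀ b ∈ B, ∀ b' ∈ B, ∀ t t' : ℕ,
      b + Finsupp.single v t = b' + Finsupp.single v t' → b = b' := by
    intro b hb b' hb' t t' heq
    rcases le_total t t' with htt | htt
    · exact huniq b hb b' hb' t t' htt heq
    · exact (huniq b' hb' b hb t' t htt heq.symm).symm
  have hbox : ∀ i m, m ∈ box (u i) (insert v (Z i)) ↔
      ∃ b ∈ box (u i) (Z i), ∃ t, m = b + Finsupp.single v t := by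
    intro i m
    constructor
    · rintro ⟨h1, h2⟩
      refine ⟨m - Finsupp.single v (m v - u i v), ⟨fun w => ?_, fun w hw => ?_⟩,
        m v - u i v, ?_⟩
      · have := h1 w
        rcases eq_or_ne v w with rfl | hne
        · simp; omega
        · simpa [hne] using this
      · rcases eq_or_ne v w with rfl | hne
        · have := h1 v
          simp; omega
        · simpa [hne] using h2 w (by simp [hw, hne.symm])
      · ext w
        rcases eq_or_ne v w with rfl | hne
        · simp
        · simp [hne]
    · rintro ⟨b, ⟨h1, h2⟩, t, rfl⟩
      refine ⟨h1.trans le_self_add, fun w hw => ?_⟩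
      simp only [Finset.mem_insert, not_or] at hw
      simp [h2 w hw.2, Ne.symm hw.1]
  refine IsStanleyPartition.hasStanleyPartition (u := u) (Z := fun i => insert v (Z i))
    ⟨?_, ?_⟩ fun i => Finset.card_pos.2 ⟨v, by simp⟩
  · intro i m hm
    obtain ⟨b, hb, t, rfl⟩ := (hbox i m).1 hm
    exact hadd t b (h.subset i hb).1
  · intro m hm
    obtain ⟨b, hb, t, rfl⟩ := hbase _ m hm rfl
    obtain ⟨i, hi, hiu⟩ := h.existsUnique b hb
    refine ⟨i, (hbox _ _).2 ⟨b, hi, t, rfl⟩, fun j hj => ?_⟩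
    obtain ⟨b', hb', t', heq⟩ := (hbox _ _).1 hj
    obtain rfl := huniq' b hb b' (h.subset j hb') t t' heq
    exact hiu j hb'

/-- Good directions can only be lost as `m` grows, by order-connectedness. Sorting `M` by the
largest good direction in a fixed linear order of the variables therefore gives order-connected
pieces `N v`, each closed under adding `e_v`. -/
lemma hasStanleyPartition_one_of_exists_direction {V : Type*} [Finite V] {M : Set (V →₀ ℕ)}
    (hM : M.OrdConnected) (hdir : ∀ m ∈ M, ∃ v, ∀ t : ℕ, m + Finsupp.single v t ∈ M) :
    HasStanleyPartition M 1 := by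
  classical
  obtain ⟨n, ⟨e⟩⟩ := Finite.exists_equiv_fin V
  let good (m : V →₀ ℕ) (v : V) : Prop := ∀ t : ℕ, m + Finsupp.single v t ∈ M
  have hgood : ∀ m ∈ M, ∀ m', m ≤ m' → ∀ v, good m' v → good m v := by
    intro m hm m' hmm' v hv t
    exact hM.out hm (hv t) ⟨le_self_add, add_le_add hmm' le_rfl⟩
  let N (v : V) : Set (V →₀ ℕ) := {m | m ∈ M ∧ good m v ∧ ∀ w, good m w → e w ≤ e v}
  have hMN : M = ⋃ v, N v := by
    ext m
    simp only [Set.mem_iUnion]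
    refine ⟨fun hm => ?_, fun ⟨v, hv⟩ => hv.1⟩
    obtain ⟨v, hv, hmax⟩ := Set.exists_max_image {v | good m v} e (Set.toFinite _) (hdir m hm)
    exact ⟨v, hm, hv, hmax⟩
  rw [hMN]
  refine HasStanleyPartition.iUnion (fun v => ?_) fun v w m hv hw =>
    e.injective (le_antisymm (hw.2.2 v hv.2.1) (hv.2.2 w hw.2.1))
  refine hasStanleyPartition_one_of_add_single_mem ?_ v ?_
  · refine ⟨fun a ha b hb m hm => ?_⟩
    have hmM := hM.out ha.1 hb.1 hm
    exact ⟨hmM, hgood m hmM b hm.2 v hb.2.1,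
      fun w hw => ha.2.2 w (hgood a ha.1 m hm.1 w hw)⟩
  · rintro m ⟨hm, hv, hmax⟩
    refine ⟨hv 1, fun t => ?_, fun w hw => hmax w (hgood m hm _ le_self_add w hw)⟩
    rw [add_assoc, ← Finsupp.single_add]
    exact hv _

/-! ### The order of a monomial with respect to a generating set. -/

/-- The largest number of elements of `S`, counted with multiplicity, whose sum is at most `m`. For
a set `S` of exponent vectors of monomials generating an ideal `I`, this is the largest `k` such
that `x^m ∈ I^k`. -/
noncomputable def order {V : Type*} (S : Set (V →₀ ℕ)) (m : V →₀ ℕ) : ℕ :=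
  sSup {k | ∃ T : Multiset (V →₀ ℕ), T.card = k ∧ (∀ s ∈ T, s ∈ S) ∧ T.sum ≤ m}

lemma card_le_degree_sum {V : Type*} {S : Set (V →₀ ℕ)} (hS : 0 ∉ S) (T : Multiset (V →₀ ℕ))
    (hT : ∀ s ∈ T, s ∈ S) : T.card ≤ T.sum.degree := by
  induction T using Multiset.induction with
  | empty => simp
  | cons a T ih =>
    have ha : a ≠ 0 := fun h => hS (h ▸ hT a (Multiset.mem_cons_self a T))
    have ha' : 0 < a.degree := by
      rw [Nat.pos_iff_ne_zero, Ne, Finsupp.degree_eq_zero_iff]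
      exact ha
    have := ih fun s hs => hT s (Multiset.mem_cons_of_mem hs)
    simp only [Multiset.card_cons, Multiset.sum_cons, map_add]
    omega

/-- Each summand has positive degree. Without a bound, the supremum in `ℕ` would take its default
value `0`. -/
lemma bddAbove_order {V : Type*} {S : Set (V →₀ ℕ)} (hS : 0 ∉ S) (m : V →₀ ℕ) :
    BddAbove {k | ∃ T : Multiset (V →₀ ℕ), T.card = k ∧ (∀ s ∈ T, s ∈ S) ∧ T.sum ≤ m} := by
  refine ⟨m.degree, ?_⟩
  rintro k ⟨T, rfl, hT, hTm⟩
  refine (card_le_degree_sum hS T hT).trans ?_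
  obtain ⟨x, rfl⟩ := exists_add_of_le hTm
  simp

lemma card_le_order {V : Type*} {S : Set (V →₀ ℕ)} (hS : 0 ∉ S) {m : V →₀ ℕ}
    {T : Multiset (V →₀ ℕ)} (hT : ∀ s ∈ T, s ∈ S) (hTm : T.sum ≤ m) : T.card ≤ order S m :=
  le_csSup (bddAbove_order hS m) ⟨T, rfl, hT, hTm⟩

lemma exists_card_eq_order {V : Type*} {S : Set (V →₀ ℕ)} (hS : 0 ∉ S) (m : V →₀ ℕ) :
    ∃ T : Multiset (V →₀ ℕ), T.card = order S m ∧ (∀ s ∈ T, s ∈ S) ∧ T.sum ≤ m :=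
  Nat.sSup_mem (s := {k | ∃ T : Multiset (V →₀ ℕ), T.card = k ∧ (∀ s ∈ T, s ∈ S) ∧ T.sum ≤ m})
    ⟨0, 0, by simp⟩ (bddAbove_order hS m)

lemma le_order_iff {V : Type*} {S : Set (V →₀ ℕ)} (hS : 0 ∉ S) {m : V →₀ ℕ} {k : ℕ} :
    k ≤ order S m ↔
      ∃ T : Multiset (V →₀ ℕ), T.card = k ∧ (∀ s ∈ T, s ∈ S) ∧ T.sum ≤ m := by
  constructor
  · intro h
    obtain ⟨T, hT, hTS, hTm⟩ := exists_card_eq_order hS m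
    obtain ⟨T', h'⟩ := Multiset.card_pos_iff_exists_mem.1
      (show 0 < (T.powersetCard k).card by
        rw [Multiset.card_powersetCard]; exact Nat.choose_pos (hT ▸ h))
    obtain ⟨hT', hTk⟩ := Multiset.mem_powersetCard.1 h'
    refine ⟨T', hTk, fun s hs => hTS s (Multiset.mem_of_le hT' hs), ?_⟩
    obtain ⟨x, rfl⟩ := exists_add_of_le hT'
    exact le_trans (by simp) hTm
  · rintro ⟨T, rfl, hT, hTm⟩
    exact card_le_order hS hT hTm

lemma order_mono {V : Type*} {S : Set (V →₀ ℕ)} (hS : 0 ∉ S) : Monotone (order S) := by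
  intro m m' h
  obtain ⟨T, hT, hTS, hTm⟩ := exists_card_eq_order hS m
  exact hT ▸ card_le_order hS hTS (hTm.trans h)

lemma multiset_sum_mem_supportedOn {V : Type*} {A : Set V} {S : Set (V →₀ ℕ)}
    (hS : S ⊆ supportedOn A) (T : Multiset (V →₀ ℕ)) (hT : ∀ s ∈ T, s ∈ S) :
    T.sum ∈ supportedOn A := by
  induction T using Multiset.induction with
  | empty => intro v _; simp
  | cons a T ih =>
    intro v hv
    simp [hS (hT a (Multiset.mem_cons_self a T)) v hv,
      ih (fun s hs => hT s (Multiset.mem_cons_of_mem hs)) v hv]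

/-- A packing splits into its members in `S₁` and the others; as the supports are disjoint, the
bound by `a + b` splits into separate bounds by `a` and by `b`. -/
lemma order_union_add {V : Type*} {A B : Set V} (hAB : Disjoint A B) {S₁ S₂ : Set (V →₀ ℕ)}
    (h₁ : 0 ∉ S₁) (h₂ : 0 ∉ S₂) (hA : S₁ ⊆ supportedOn A) (hB : S₂ ⊆ supportedOn B)
    {a b : V →₀ ℕ} (ha : a ∈ supportedOn A) (hb : b ∈ supportedOn B) :
    order (S₁ ∪ S₂) (a + b) = order S₁ a + order S₂ b := by
  classical
  have h₁₂ : 0 ∉ S₁ ∪ S₂ := fun h => h.elim h₁ h₂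
  apply le_antisymm
  · obtain ⟨T, hT, hTS, hTm⟩ := exists_card_eq_order h₁₂ (a + b)
    rw [← Multiset.filter_add_not (· ∈ S₁) T] at hTm hT
    have hT₁ : ∀ s ∈ T.filter (· ∈ S₁), s ∈ S₁ := fun s hs => (Multiset.mem_filter.1 hs).2
    have hT₂ : ∀ s ∈ T.filter (¬ · ∈ S₁), s ∈ S₂ := fun s hs =>
      (hTS s (Multiset.mem_filter.1 hs).1).resolve_left (Multiset.mem_filter.1 hs).2
    rw [Multiset.sum_add, add_le_add_iff_of_supportedOn hAB
      (multiset_sum_mem_supportedOn hA _ hT₁) ha (multiset_sum_mem_supportedOn hB _ hT₂) hb] at hTm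
    rw [← hT, Multiset.card_add]
    exact add_le_add (card_le_order h₁ hT₁ hTm.1) (card_le_order h₂ hT₂ hTm.2)
  · obtain ⟨T, hT, hTS, hTm⟩ := exists_card_eq_order h₁ a
    obtain ⟨T', hT', hTS', hTm'⟩ := exists_card_eq_order h₂ b
    rw [← hT, ← hT', ← Multiset.card_add]
    refine card_le_order h₁₂ (fun s hs => ?_) ?_
    · exact (Multiset.mem_add.1 hs).imp (hTS s) (hTS' s)
    · rw [Multiset.sum_add]
      exact add_le_add hTm hTm'

/-! ### Level and superlevel sets of an additive function. -/

/-- Exponent vectors supported on `A` on which `ν` takes the value `j`. -/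
def level {V : Type*} (A : Set V) (ν : (V →₀ ℕ) → ℕ) (j : ℕ) : Set (V →₀ ℕ) :=
  {m | m ∈ supportedOn A ∧ ν m = j}

/-- Exponent vectors supported on `A` on which `ν` takes a value at least `j`. -/
def superlevel {V : Type*} (A : Set V) (ν : (V →₀ ℕ) → ℕ) (j : ℕ) : Set (V →₀ ℕ) :=
  {m | m ∈ supportedOn A ∧ j ≤ ν m}

lemma ordConnected_level {V : Type*} (A : Set V) {ν : (V →₀ ℕ) → ℕ} (hν : Monotone ν) (j : ℕ) :
    (level A ν j).OrdConnected := by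
  refine ⟨fun a ha b hb m hm => ⟨fun v hv => ?_, ?_⟩⟩
  · exact Nat.eq_zero_of_le_zero ((hm.2 v).trans (hb.1 v hv).le)
  · exact le_antisymm ((hν hm.2).trans hb.2.le) (ha.2.ge.trans (hν hm.1))

lemma ordConnected_superlevel {V : Type*} (A : Set V) {ν : (V →₀ ℕ) → ℕ} (hν : Monotone ν)
    (j : ℕ) : (superlevel A ν j).OrdConnected := by
  refine ⟨fun a ha b hb m hm => ⟨fun v hv => ?_, ha.2.trans (hν hm.1)⟩⟩
  exact Nat.eq_zero_of_le_zero ((hm.2 v).trans (hb.1 v hv).le)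

lemma hasStanleyPartition_level_union {V : Type*} {A B : Set V} (hAB : Disjoint A B)
    {ν ν₁ ν₂ : (V →₀ ℕ) → ℕ} {d₁ d₂ : ℕ}
    (hν : ∀ a ∈ supportedOn A, ∀ b ∈ supportedOn B, ν (a + b) = ν₁ a + ν₂ b)
    (h₁ : ∀ j, HasStanleyPartition (level A ν₁ j) d₁)
    (h₂ : ∀ j, HasStanleyPartition (level B ν₂ j) d₂) (j : ℕ) :
    HasStanleyPartition (level (A ∪ B) ν j) (d₁ + d₂) := by
  have : level (A ∪ B) ν j = ⋃ i : Fin (j + 1), (level A ν₁ i + level B ν₂ (j - i)) := by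
    ext m
    simp only [Set.mem_iUnion]
    constructor
    · rintro ⟨hm, hmj⟩
      obtain ⟨a, ha, b, hb, rfl⟩ := exists_add_eq_of_supportedOn_union hAB hm
      rw [hν a ha b hb] at hmj
      refine ⟨⟨ν₁ a, by omega⟩, Set.add_mem_add ⟨ha, rfl⟩ ⟨hb, ?_⟩⟩
      simp only
      omega
    · rintro ⟨i, a, ha, b, hb, rfl⟩
      refine ⟨add_mem_supportedOn ha.1 hb.1, ?_⟩
      have h1 := ha.2
      have h2 := hb.2
      have h3 := i.2
      rw [hν a ha.1 b hb.1]
      omega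
  rw [this]
  refine HasStanleyPartition.iUnion (fun i => (h₁ i).add hAB (fun _ h => h.1) (fun _ h => h.1)
    (h₂ _)) ?_
  rintro i i' m ⟨a, ha, b, hb, rfl⟩ ⟨a', ha', b', hb', heq⟩
  obtain ⟨rfl, rfl⟩ := (add_eq_add_iff_of_supportedOn hAB ha'.1 ha.1 hb'.1 hb.1).1 heq
  exact Fin.ext (ha.2.symm.trans ha'.2)

/-- The sums `a + b` are sorted by `min (ν₁ a) k`. The truncation leaves finitely many pieces, and
it makes the piece `i = k` the superlevel set on `A` times all of `B`. Exact levels are needed only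
on `A`: on `B` powers suffice, including the zeroth. -/
lemma hasStanleyPartition_superlevel_union {V : Type*} {A B : Set V} (hAB : Disjoint A B)
    {ν ν₁ ν₂ : (V →₀ ℕ) → ℕ} {d₁ d₂ : ℕ}
    (hν : ∀ a ∈ supportedOn A, ∀ b ∈ supportedOn B, ν (a + b) = ν₁ a + ν₂ b) (k : ℕ)
    (h₁ : ∀ j < k, HasStanleyPartition (level A ν₁ j) d₁)
    (h₁' : HasStanleyPartition (superlevel A ν₁ k) d₁)
    (h₂ : ∀ l ≤ k, HasStanleyPartition (superlevel B ν₂ l) d₂) :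
    HasStanleyPartition (superlevel (A ∪ B) ν k) (d₁ + d₂) := by
  have hlevel : ∀ i ≤ k, HasStanleyPartition (level A (fun m => min (ν₁ m) k) i) d₁ := by
    intro i hi
    rcases hi.lt_or_eq with hi | rfl
    · convert h₁ i hi using 1
      ext m
      simp only [level, Set.mem_ofPred_eq, and_congr_right_iff]
      intro; omega
    · convert h₁' using 1
      ext m
      simp only [level, superlevel, Set.mem_ofPred_eq, and_congr_right_iff]
      intro; omega
  have : superlevel (A ∪ B) ν k = ⋃ i : Fin (k + 1),
      (level A (fun m => min (ν₁ m) k) i + superlevel B ν₂ (k - i)) := by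
    ext m
    simp only [Set.mem_iUnion]
    constructor
    · rintro ⟨hm, hmj⟩
      obtain ⟨a, ha, b, hb, rfl⟩ := exists_add_eq_of_supportedOn_union hAB hm
      rw [hν a ha b hb] at hmj
      refine ⟨⟨min (ν₁ a) k, by omega⟩, Set.add_mem_add ⟨ha, rfl⟩ ⟨hb, ?_⟩⟩
      simp only
      omega
    · rintro ⟨i, a, ha, b, hb, rfl⟩
      refine ⟨add_mem_supportedOn ha.1 hb.1, ?_⟩
      have h1 := ha.2
      have h2 := hb.2
      have h3 := i.2
      simp only at h1
      rw [hν a ha.1 b hb.1]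
      omega
  rw [this]
  refine HasStanleyPartition.iUnion (fun i => (hlevel i (by omega)).add hAB (fun _ h => h.1)
    (fun _ h => h.1) (h₂ _ (Nat.sub_le _ _))) ?_
  rintro i i' m ⟨a, ha, b, hb, rfl⟩ ⟨a', ha', b', hb', heq⟩
  obtain ⟨rfl, rfl⟩ := (add_eq_add_iff_of_supportedOn hAB ha'.1 ha.1 hb'.1 hb.1).1 heq
  exact Fin.ext (ha.2.symm.trans ha'.2)

/-! ### Weighted Kőnig duality and free directions. -/

/-- The weighted Kőnig theorem for a bipartite graph: if every vertex cover has weight at least `n`,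
then `n` edges, counted with multiplicity, can be packed below the weight function. -/
lemma exists_edge_packing {V : Type*} [Fintype V] [DecidableEq V] {E : Set (V × V)}
    {L R : Finset V} (hLR : Disjoint L R) (hE : ∀ p ∈ E, p.1 ∈ L ∧ p.2 ∈ R) (n : ℕ) :
    ∀ m : V →₀ ℕ, (∀ C : Finset V, (∀ p ∈ E, p.1 ∈ C ∨ p.2 ∈ C) → n ≤ ∑ v ∈ C, m v) →
    ∃ T : Multiset (V →₀ ℕ), T.card = n ∧
      (∀ s ∈ T, s ∈ {s | ∃ p ∈ E, s = Finsupp.single p.1 1 + Finsupp.single p.2 1}) ∧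
      T.sum ≤ m := by
  have hLR' : ∀ x ∈ L, x ∉ R := fun x hx => Finset.disjoint_left.1 hLR hx
  classical
  induction n with
  | zero => intro m _; exact ⟨0, by simp⟩
  | succ n ih =>
    intro m hm
    -- Vertices of weight zero can be added to a cover at no cost.
    let zeros : Finset V := Finset.univ.filter fun v => m v = 0
    have hzeros : ∀ v, v ∈ zeros ↔ m v = 0 := by simp [zeros]
    have hzsum : ∀ D : Finset V, ∑ v ∈ D ∪ zeros, m v = ∑ v ∈ D, m v := by
      intro D
      refine (Finset.sum_subset Finset.subset_union_left fun x hx hx' => ?_).symm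
      exact (hzeros x).1 ((Finset.mem_union.1 hx).resolve_left hx')
    -- Such an edge can be packed first: after subtracting it from `m`, a cover loses 1 if it
    -- contains one endpoint and 2 if it contains both, so every cover still weighs at least `n`.
    obtain ⟨p, hpE, hp1, hp2, hp⟩ : ∃ p ∈ E, 0 < m p.1 ∧ 0 < m p.2 ∧
        ∀ C : Finset V, (∀ p ∈ E, p.1 ∈ C ∨ p.2 ∈ C) → p.1 ∈ C → p.2 ∈ C →
          n + 2 ≤ ∑ v ∈ C, m v := by
      by_contra! hcon
      have hpos : ∃ p ∈ E, 0 < m p.1 ∧ 0 < m p.2 := by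
        by_contra! h0
        have := hm (∅ ∪ zeros) fun p hp => by
          simp only [Finset.empty_union, hzeros]
          have := h0 p hp
          omega
        rw [hzsum] at this
        simp at this
      obtain ⟨⟨u, v⟩, huvE, hu, hv⟩ := hpos
      -- If there is no such edge, fix `u` on an edge of positive weights. Among the covers through
      -- `u` of weight at most `n + 1`, take `D` with the most vertices in `R`.
      have hne : (Finset.univ.filter fun C : Finset V =>
          (∀ p ∈ E, p.1 ∈ C ∨ p.2 ∈ C) ∧ u ∈ C ∧ ∑ v ∈ C, m v ≤ n + 1).Nonempty := by
        obtain ⟨C, hC, huC, -, hCn⟩ := hcon (u, v) huvE hu hv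
        exact ⟨C, by simp only [Finset.mem_filter, Finset.mem_univ, true_and]
                     exact ⟨hC, huC, by omega⟩⟩
      obtain ⟨D, hD, hmax⟩ := Finset.exists_max_image _ (fun C => (C ∩ R).card) hne
      simp only [Finset.mem_filter, Finset.mem_univ, true_and] at hD hmax
      obtain ⟨hDc, huD, hDn⟩ := hD
      -- Otherwise `D` without `u`, enlarged by the zero vertices, would be a cover lighter than `n
      -- + 1`.
      obtain ⟨q, hqE, hqD, hq⟩ : ∃ q, (u, q) ∈ E ∧ q ∉ D ∧ 0 < m q := by
        by_contra! hq
        have h1 := hm (D.erase u ∪ zeros) fun p hp => by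
          obtain ⟨x, y⟩ := p
          have hx := hE _ hp
          simp only [Finset.mem_union, Finset.mem_erase, hzeros]
          have huL := (hE _ huvE).1
          have hyu : y ≠ u := fun h => hLR' u huL (h ▸ hx.2)
          have hc := hDc _ hp
          by_cases hxu : x = u
          · subst hxu
            by_cases hyD : y ∈ D
            · exact Or.inr (Or.inl ⟨hyu, hyD⟩)
            · have := hq y hp hyD
              exact Or.inr (Or.inr (by omega))
          · rcases hc with hc | hc
            · exact Or.inl (Or.inl ⟨hxu, hc⟩)
            · exact Or.inr (Or.inl ⟨hyu, hc⟩)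
        rw [hzsum] at h1
        have := Finset.add_sum_erase D m huD
        simp only at hu
        omega
      obtain ⟨C, hC, huC, hqC, hCn⟩ := hcon (u, q) hqE hu hq
      simp only at huC hqC
      -- Uncrossing: `D₁` and `D₂` are covers of total weight at most that of `D` and `C`, hence at
      -- most `2 * (n + 1)`. As `D₂` weighs at least `n + 1`, `D₁` weighs at most `n + 1`; but it
      -- contains `u` and has the additional vertex `q` in `R`, against the choice of `D`.
      let D₁ := ((D ∩ C) ∩ L) ∪ ((D ∪ C) ∩ R)
      let D₂ := ((D ∪ C) ∩ L) ∪ ((D ∩ C) ∩ R)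
      have hD₁ : ∀ p ∈ E, p.1 ∈ D₁ ∨ p.2 ∈ D₁ := by
        intro p hp
        have := hE p hp
        have := hDc p hp
        have := hC p hp
        simp only [D₁, Finset.mem_union, Finset.mem_inter]
        tauto
      have hD₂ : ∀ p ∈ E, p.1 ∈ D₂ ∨ p.2 ∈ D₂ := by
        intro p hp
        have := hE p hp
        have := hDc p hp
        have := hC p hp
        simp only [D₂, Finset.mem_union, Finset.mem_inter]
        tauto
      have hsum : ∑ v ∈ D₁, m v + ∑ v ∈ D₂, m v ≤ ∑ v ∈ D, m v + ∑ v ∈ C, m v := by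
        have key : ∀ X : Finset V, ∑ v ∈ X, m v = ∑ v, if v ∈ X then m v else 0 := by
          intro X; simp
        rw [key, key D₂, key D, key C, ← Finset.sum_add_distrib, ← Finset.sum_add_distrib]
        refine Finset.sum_le_sum fun x _ => ?_
        by_cases h3 : x ∈ L
        · have h4 := hLR' x h3
          by_cases h1 : x ∈ D <;> by_cases h2 : x ∈ C <;> simp [D₁, D₂, h1, h2, h3, h4]
        · by_cases h1 : x ∈ D <;> by_cases h2 : x ∈ C <;> by_cases h4 : x ∈ R <;>
            simp [D₁, D₂, h1, h2, h3, h4]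
      have hsub : (D ∩ R).card < (D₁ ∩ R).card := by
        refine Finset.card_lt_card ⟨fun x hx => ?_, fun h => hqD ?_⟩
        · simp only [D₁, Finset.mem_union, Finset.mem_inter] at hx ⊢
          tauto
        · have hqR := (hE _ hqE).2
          refine (Finset.mem_inter.1 (h (?_ : q ∈ D₁ ∩ R))).1
          simp only [D₁, Finset.mem_union, Finset.mem_inter]
          tauto
      have hle := hmax D₁ ⟨hD₁, by
        have huL := (hE _ huvE).1
        simp only [D₁, Finset.mem_union, Finset.mem_inter]
        tauto, by
        have := hm D₂ hD₂
        omega⟩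
      omega
    obtain ⟨u, v⟩ := p
    simp only at hp1 hp2 hp
    have huv : u ≠ v := by
      rintro rfl
      exact hLR' u (hE _ hpE).1 (hE _ hpE).2
    have hle : Finsupp.single u 1 + Finsupp.single v 1 ≤ m := by
      intro w
      by_cases h1 : u = w
      · subst h1
        simp [huv.symm]; omega
      · by_cases h2 : v = w
        · subst h2
          simp [huv]; omega
        · simp [h1, h2]
    obtain ⟨m', rfl⟩ := exists_add_of_le hle
    obtain ⟨T, hT, hTE, hTm⟩ := ih m' fun C hC => by
      have h1 := hm C hC
      have h2 := hp C hC
      simp only [Finsupp.coe_add, Pi.add_apply, Finset.sum_add_distrib,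
        Finsupp.single_apply, Finset.sum_ite_eq] at h1 h2
      by_cases huC : u ∈ C <;> by_cases hvC : v ∈ C <;> simp [huC, hvC] at h1 h2 <;> omega
    refine ⟨(Finsupp.single u 1 + Finsupp.single v 1) ::ₘ T, by simp [hT], ?_, ?_⟩
    · intro s hs
      rcases Multiset.mem_cons.1 hs with rfl | hs
      · exact ⟨_, hpE, rfl⟩
      · exact hTE s hs
    · rw [Multiset.sum_cons]
      exact add_le_add le_rfl hTm

/-- Weak duality: every packed edge contributes at least 1 to the weight of a cover. -/
lemma multiset_card_le_sum_cover {V : Type*} {E : Set (V × V)} {C : Finset V}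
    (hC : ∀ p ∈ E, p.1 ∈ C ∨ p.2 ∈ C) (T : Multiset (V →₀ ℕ))
    (hT : ∀ s ∈ T, s ∈ {s | ∃ p ∈ E, s = Finsupp.single p.1 1 + Finsupp.single p.2 1}) :
    T.card ≤ ∑ v ∈ C, T.sum v := by
  classical
  induction T using Multiset.induction with
  | empty => simp
  | cons a T ih =>
    have := ih fun s hs => hT s (Multiset.mem_cons_of_mem hs)
    obtain ⟨p, hp, rfl⟩ := hT a (Multiset.mem_cons_self a T)
    simp only [Multiset.card_cons, Multiset.sum_cons, Finsupp.coe_add, Pi.add_apply,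
      Finset.sum_add_distrib, Finsupp.single_apply, Finset.sum_ite_eq]
    rcases hC p hp with h | h <;> simp only [h, if_true] <;> omega

/-- For a bipartite graph, some variable can be multiplied into a monomial arbitrarily often without
changing the order of the monomial with respect to the edge ideal. -/
lemma exists_order_add_single_eq {V : Type*} [Finite V] {E : Set (V × V)} {L R : Set V}
    (hLR : Disjoint L R) (hE : ∀ p ∈ E, p.1 ∈ L ∧ p.2 ∈ R) (hne : (L ∪ R).Nonempty)
    {S : Set (V →₀ ℕ)} (hS : 0 ∉ S)
    (hSE : S = {s | ∃ p ∈ E, s = Finsupp.single p.1 1 + Finsupp.single p.2 1}) (m : V →₀ ℕ) :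
    ∃ v ∈ L ∪ R, ∀ t : ℕ, order S (m + Finsupp.single v t) = order S m := by
  classical
  have := Fintype.ofFinite V
  obtain ⟨C, hC, hCm⟩ : ∃ C : Finset V, (∀ p ∈ E, p.1 ∈ C ∨ p.2 ∈ C) ∧
      ∑ v ∈ C, m v ≤ order S m := by
    by_contra! hcon
    obtain ⟨T, hT, hTE, hTm⟩ := exists_edge_packing (L := L.toFinset) (R := R.toFinset)
      (by simpa using hLR) (by simpa using hE) (order S m + 1) m hcon
    have := card_le_order (S := S) hS (hSE ▸ hTE) hTm
    omega
  -- A cover containing all of `L ∪ R` can be replaced by `L` or `R` alone, whichever misses a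
  -- vertex of the nonempty union.
  have key : ∃ C : Finset V, (∀ p ∈ E, p.1 ∈ C ∨ p.2 ∈ C) ∧ ∑ v ∈ C, m v ≤ order S m ∧
      ∃ v ∈ L ∪ R, v ∉ C := by
    by_cases h : ∃ v ∈ L ∪ R, v ∉ C
    · exact ⟨C, hC, hCm, h⟩
    · push Not at h
      have hmono : ∀ X : Set V, X ⊆ L ∪ R → ∑ v ∈ X.toFinset, m v ≤ order S m := fun X hX =>
        (Finset.sum_le_sum_of_subset fun x hx => h x (hX (Set.mem_toFinset.1 hx))).trans hCm
      obtain ⟨v, hv⟩ := hne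
      rcases hv with hv | hv
      · exact ⟨R.toFinset, fun p hp => Or.inr (by simpa using (hE p hp).2),
          hmono R Set.subset_union_right, v, Or.inl hv,
          by simpa using Set.disjoint_left.1 hLR hv⟩
      · exact ⟨L.toFinset, fun p hp => Or.inl (by simpa using (hE p hp).1),
          hmono L Set.subset_union_left, v, Or.inr hv,
          by simpa using Set.disjoint_right.1 hLR hv⟩
  obtain ⟨C, hC, hCm, v, hv, hvC⟩ := key
  refine ⟨v, hv, fun t => le_antisymm ?_ (order_mono hS le_self_add)⟩
  -- Since `v ∉ C`, the weight of `C` does not grow with `t`, and it still bounds the order.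
  obtain ⟨T, hT, hTS, hTm⟩ := exists_card_eq_order hS (m + Finsupp.single v t)
  rw [← hT]
  refine (multiset_card_le_sum_cover hC T (hSE ▸ hTS)).trans (le_trans ?_ hCm)
  refine Finset.sum_le_sum fun w hw => (hTm w).trans ?_
  have : v ≠ w := by rintro rfl; exact hvC hw
  simp [this]

/-! ### Stanley decompositions of monomial ideals versus box partitions. -/

/-- The exponent vectors of the monomials in an ideal. -/
def exponents {σ K : Type*} [Field K] (I : Ideal (MvPolynomial σ K)) : Set (σ →₀ ℕ) :=
  {m | monomial m (1 : K) ∈ I}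

lemma weight_single_one_apply {σ : Type*} (d : σ →₀ ℕ) (i : σ) :
    Finsupp.weight (fun i : σ => Finsupp.single i (1 : ℤ)) d i = d i := by
  classical
  induction d using Finsupp.induction_linear with
  | zero => simp
  | add f g hf hg => simp [hf, hg]
  | single j n =>
    rw [Finsupp.weight_single, Finsupp.smul_apply, Finsupp.single_apply, Finsupp.single_apply]
    split_ifs <;> simp

/-- A multidegree determines the exponent vector, so only one coefficient can be nonzero. -/
lemma exists_eq_monomial_of_mem_idealComponent {σ K : Type*} [Field K]
    {I : Ideal (MvPolynomial σ K)} {u : I} {b : σ →₀ ℤ} (hu : u ∈ idealComponent I b)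
    (h0 : u ≠ 0) : ∃ a c, c ≠ 0 ∧ (u : MvPolynomial σ K) = monomial a c := by
  classical
  have hu' : IsWeightedHomogeneous (fun i : σ => Finsupp.single i (1 : ℤ))
      (u : MvPolynomial σ K) b := hu
  obtain ⟨a, ha⟩ := MvPolynomial.ne_zero_iff.1 fun h => h0 (Subtype.ext h)
  refine ⟨a, coeff a (u : MvPolynomial σ K), ha, ?_⟩
  ext m
  rw [coeff_monomial]
  split_ifs with h
  · rw [h]
  · by_contra hm
    apply h
    ext i
    have h1 := DFunLike.congr_fun (hu' ha) i
    have h2 := DFunLike.congr_fun (hu' hm) i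
    rw [weight_single_one_apply] at h1 h2
    exact_mod_cast h1.trans h2.symm

lemma mem_idealComponent_of_eq_monomial {σ K : Type*} [Field K] {I : Ideal (MvPolynomial σ K)}
    {u : I} {a : σ →₀ ℕ} {c : K} (hu : (u : MvPolynomial σ K) = monomial a c) :
    u ∈ idealComponent I (Finsupp.weight (fun i : σ => Finsupp.single i (1 : ℤ)) a) := by
  change IsWeightedHomogeneous _ (u : MvPolynomial σ K) _
  rw [hu]
  exact isWeightedHomogeneous_monomial _ _ _ rfl

/-- A Stanley space of an ideal consists of the polynomials supported in a box. -/
lemma mem_stanleySpace_iff {σ K : Type*} [Field K] {I : Ideal (MvPolynomial σ K)} {u : I}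
    {a : σ →₀ ℕ} {c : K} (hc : c ≠ 0) (hu : (u : MvPolynomial σ K) = monomial a c)
    {Z : Finset σ} {p : I} :
    p ∈ stanleySpace (K := K) u Z ↔ ∀ m ∈ (p : MvPolynomial σ K).support, m ∈ box a Z := by
  classical
  constructor
  · rintro ⟨f, hf, rfl⟩ m hm
    have hf' : (f.vars : Set σ) ⊆ Z := mem_supported.1 hf
    have hm' : coeff m (f * monomial a c) ≠ 0 := by
      rw [← hu]
      exact mem_support_iff.1 hm
    rw [coeff_mul_monomial'] at hm'
    split_ifs at hm' with ham
    · refine ⟨ham, fun v hv => ?_⟩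
      by_contra hne
      have hma : m - a ∈ f.support := mem_support_iff.2 (left_ne_zero_of_mul hm')
      have : v ∈ f.vars := mem_vars_iff_mem_support v |>.2 ⟨m - a, hma, by
        have := ham v
        simp only [Finsupp.mem_support_iff, Finsupp.tsub_apply]
        omega⟩
      exact hv (hf' this)
    · exact absurd rfl hm'
  · intro h
    refine ⟨∑ m ∈ (p : MvPolynomial σ K).support,
      monomial (m - a) (coeff m (p : MvPolynomial σ K) * c⁻¹), ?_, ?_⟩
    · refine Subalgebra.sum_mem _ fun m hm => ?_
      rw [mem_supported, vars_monomial (mul_ne_zero (mem_support_iff.1 hm) (inv_ne_zero hc))]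
      intro v hv
      by_contra hvZ
      have := (h m hm).2 v hvZ
      simp [this] at hv
    · apply Subtype.ext
      change (∑ m ∈ (p : MvPolynomial σ K).support,
        monomial (m - a) (coeff m (p : MvPolynomial σ K) * c⁻¹)) * (u : MvPolynomial σ K) = p
      rw [hu, Finset.sum_mul]
      conv_rhs => rw [(p : MvPolynomial σ K).as_sum]
      refine Finset.sum_congr rfl fun m hm => ?_
      rw [monomial_mul, tsub_add_cancel_of_le (h m hm).1, inv_mul_cancel_right₀ hc]

/-- The hypothesis `hI` expresses that `I` is a monomial ideal; it makes the Stanley spaces of the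
boxes span `I`. -/
lemma le_idealSdepth_of_hasStanleyPartition {σ K : Type*} [Field K]
    {I : Ideal (MvPolynomial σ K)}
    (hI : ∀ p ∈ I, ∀ m ∈ p.support, m ∈ exponents I) {d : ℕ}
    (h : HasStanleyPartition (exponents I) d) : (d : ℕ∞) ≤ idealSdepth I := by
  classical
  obtain ⟨r, u, Z, h, hd⟩ := h
  let w : Fin r → I := fun i => ⟨monomial (u i) 1, h.subset i (self_mem_box _ _)⟩
  have hw : ∀ i, (w i : MvPolynomial σ K) = monomial (u i) 1 := fun i => rfl
  have hmem : ∀ i p, p ∈ stanleySpace (K := K) (w i) (Z i) ↔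
      ∀ m ∈ (p : MvPolynomial σ K).support, m ∈ box (u i) (Z i) :=
    fun i p => mem_stanleySpace_iff one_ne_zero (hw i)
  have hdec : IsStanleyDecomposition (K := K) (idealComponent I) w Z := by
    refine ⟨fun i => ⟨_, mem_idealComponent_of_eq_monomial (hw i)⟩, ?_, ?_⟩
    · intro i f _ hf0
      have : f * monomial (u i) (1 : K) = 0 := congrArg Subtype.val hf0
      exact (mul_eq_zero.1 this).resolve_right (by simp [monomial_eq_zero])
    · rw [DirectSum.isInternal_submodule_iff_iSupIndep_and_iSup_eq_top]
      constructor
      · intro i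
        rw [Submodule.disjoint_def]
        intro p hp hp'
        have hle : (⨆ j, ⨆ (_ : j ≠ i), stanleySpace (K := K) (w j) (Z j)) ≤
            (restrictSupport K (⋃ j ∈ {j | j ≠ i}, box (u j) (Z j))).comap
              ((Submodule.subtype I).restrictScalars K) := by
          refine iSup₂_le fun j hj q hq => ?_
          rw [Submodule.mem_comap, mem_restrictSupport_iff]
          intro m hm
          exact Set.mem_iUnion₂.2 ⟨j, hj, (hmem j q).1 hq m hm⟩
        have hp'' := hle hp'
        rw [Submodule.mem_comap, mem_restrictSupport_iff] at hp''
        by_contra hp0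
        obtain ⟨m, hm⟩ := MvPolynomial.support_nonempty.2
          (show (p : MvPolynomial σ K) ≠ 0 from fun h => hp0 (Subtype.ext h))
        obtain ⟨j, hj, hmj⟩ := Set.mem_iUnion₂.1 (hp'' hm)
        have hmi := (hmem i p).1 hp m hm
        exact hj ((h.existsUnique m (h.subset i hmi)).unique hmj hmi)
      · rw [eq_top_iff]
        intro p _
        have hterm : ∀ m ∈ (p : MvPolynomial σ K).support,
            monomial m (coeff m (p : MvPolynomial σ K)) ∈
              (⨆ i, stanleySpace (K := K) (w i) (Z i)).map
                ((Submodule.subtype I).restrictScalars K) := by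
          intro m hm
          have hmI := hI p p.2 m hm
          obtain ⟨i, hi, -⟩ := h.existsUnique m hmI
          have hq : monomial m (coeff m (p : MvPolynomial σ K)) ∈ I := by
            have := I.mul_mem_left (C (coeff m (p : MvPolynomial σ K))) hmI
            rwa [C_mul_monomial, mul_one] at this
          refine ⟨⟨_, hq⟩, Submodule.mem_iSup_of_mem i ((hmem i _).2 fun m' hm' => ?_), rfl⟩
          obtain rfl := Finset.mem_singleton.1 (support_monomial_subset hm')
          exact hi
        have hsum := Submodule.sum_mem _ hterm
        rw [← (p : MvPolynomial σ K).as_sum] at hsum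
        obtain ⟨q, hq, hqp⟩ := hsum
        obtain rfl : q = p := Subtype.ext hqp
        exact hq
  exact le_trans (le_iInf fun i => by exact_mod_cast hd i)
    (le_iSup_of_le r (le_iSup_of_le w (le_iSup_of_le Z (le_iSup_of_le hdec le_rfl))))

lemma IsStanleyDecomposition.exists_isStanleyPartition {σ K : Type*} [Field K]
    {I : Ideal (MvPolynomial σ K)} {r : ℕ} {w : Fin r → I} {Z : Fin r → Finset σ}
    (h : IsStanleyDecomposition (K := K) (idealComponent I) w Z) :
    ∃ u : Fin r → σ →₀ ℕ, IsStanleyPartition (exponents I) u Z := by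
  classical
  -- Freeness, tested on the scalar 1, excludes zero generators.
  have hw0 : ∀ i, w i ≠ 0 := fun i h0 =>
    one_ne_zero (h.free i 1 (Subalgebra.one_mem _) (by rw [h0, smul_zero]))
  have hex : ∀ i, ∃ a c, c ≠ 0 ∧ (w i : MvPolynomial σ K) = monomial a c := by
    intro i
    obtain ⟨b, hb⟩ := h.homogeneous i
    exact exists_eq_monomial_of_mem_idealComponent hb (hw0 i)
  choose u c hc hw using hex
  have hmem : ∀ i p, p ∈ stanleySpace (K := K) (w i) (Z i) ↔
      ∀ m ∈ (p : MvPolynomial σ K).support, m ∈ box (u i) (Z i) :=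
    fun i p => mem_stanleySpace_iff (hc i) (hw i)
  have hmono : ∀ i m (hm : monomial m (1 : K) ∈ I),
      (⟨monomial m 1, hm⟩ : I) ∈ stanleySpace (K := K) (w i) (Z i) ↔ m ∈ box (u i) (Z i) := by
    intro i m hm
    rw [hmem]
    simp [support_monomial]
  obtain ⟨hind, htop⟩ :=
    (DirectSum.isInternal_submodule_iff_iSupIndep_and_iSup_eq_top _).1 h.isInternal
  have hsub : ∀ i, box (u i) (Z i) ⊆ exponents I := by
    intro i m hm
    have := I.mul_mem_left (monomial (m - u i) (c i)⁻¹) (w i).2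
    rwa [hw, monomial_mul, tsub_add_cancel_of_le hm.1, inv_mul_cancel₀ (hc i)] at this
  refine ⟨u, hsub, fun m hm => ?_⟩
  have hle : (⨆ j, stanleySpace (K := K) (w j) (Z j)) ≤
      (restrictSupport K (⋃ j, box (u j) (Z j))).comap
        ((Submodule.subtype I).restrictScalars K) := by
    refine iSup_le fun j q hq => ?_
    rw [Submodule.mem_comap, mem_restrictSupport_iff]
    intro m hm
    exact Set.mem_iUnion.2 ⟨j, (hmem j q).1 hq m hm⟩
  have hmtop : (⟨monomial m 1, hm⟩ : I) ∈ ⨆ j, stanleySpace (K := K) (w j) (Z j) := by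
    rw [htop]; trivial
  have hmU := hle hmtop
  rw [Submodule.mem_comap, mem_restrictSupport_iff] at hmU
  obtain ⟨i, hi⟩ := Set.mem_iUnion.1 (hmU (show m ∈ _ by simp [support_monomial]))
  refine ⟨i, hi, fun j hj => ?_⟩
  by_contra hne
  have := Submodule.disjoint_def.1 (hind.pairwiseDisjoint hne) _ ((hmono j m hm).2 hj)
    ((hmono i m hm).2 hi)
  have h0 : monomial m (1 : K) = 0 := congrArg Subtype.val this
  simp [monomial_eq_zero] at h0

lemma hasStanleyPartition_of_le_idealSdepth {σ K : Type*} [Field K] [Finite σ]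
    {I : Ideal (MvPolynomial σ K)} {d : ℕ} (hd : (d : ℕ∞) ≤ idealSdepth I) :
    HasStanleyPartition (exponents I) d := by
  cases d with
  | zero =>
    -- A lower bound of 0 on a supremum yields no decomposition, so one is constructed. For `d + 1`,
    -- the strict inequality with `d` yields one.
    refine hasStanleyPartition_of_ordConnected ⟨fun a ha b _ m hm => ?_⟩
    have := I.mul_mem_left (monomial (m - a) (1 : K)) (show monomial a (1 : K) ∈ I from ha)
    rwa [monomial_mul, tsub_add_cancel_of_le hm.1, one_mul] at this
  | succ d =>
    have hlt : (d : ℕ∞) < idealSdepth I :=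
      lt_of_lt_of_le (by exact_mod_cast Nat.lt_succ_self d) hd
    simp only [idealSdepth, sdepth, lt_iSup_iff] at hlt
    obtain ⟨r, w, Z, hdec, hlt⟩ := hlt
    obtain ⟨u, hu⟩ := hdec.exists_isStanleyPartition
    refine ⟨r, u, Z, hu, fun i => ?_⟩
    have := hlt.trans_le (iInf_le _ i)
    exact_mod_cast this

/-! ### Powers of monomial ideals as superlevel sets of the order. -/

lemma span_monomial_image_pow {σ K : Type*} [Field K] (S : Set (σ →₀ ℕ)) (k : ℕ) :
    Ideal.span ((fun m => monomial m (1 : K)) '' S) ^ k =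
      Ideal.span ((fun m => monomial m (1 : K)) ''
        {m | ∃ T : Multiset (σ →₀ ℕ), T.card = k ∧ (∀ s ∈ T, s ∈ S) ∧ T.sum = m}) := by
  induction k with
  | zero =>
    rw [pow_zero, eq_comm, Ideal.one_eq_top, Ideal.eq_top_iff_one]
    exact Ideal.subset_span ⟨0, ⟨0, by simp⟩, rfl⟩
  | succ k ih =>
    rw [pow_succ, ih, Ideal.span_mul_span']
    congr 1
    ext p
    constructor
    · rintro ⟨_, ⟨_, ⟨T, hT, hTS, rfl⟩, rfl⟩, _, ⟨s, hs, rfl⟩, rfl⟩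
      refine ⟨s + T.sum, ⟨s ::ₘ T, by simp [hT], fun t ht => ?_, by simp⟩, ?_⟩
      · rcases Multiset.mem_cons.1 ht with rfl | ht
        exacts [hs, hTS t ht]
      · simp [monomial_mul, add_comm]
    · rintro ⟨_, ⟨T, hT, hTS, rfl⟩, rfl⟩
      obtain ⟨s, hs⟩ := Multiset.card_pos_iff_exists_mem.1 (show 0 < T.card by omega)
      obtain ⟨T', rfl⟩ := Multiset.exists_cons_of_mem hs
      refine ⟨_, ⟨T'.sum, ⟨T', by simpa using hT,
        fun t ht => hTS t (Multiset.mem_cons_of_mem ht), rfl⟩, rfl⟩, _,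
        ⟨_, hTS _ (Multiset.mem_cons_self _ _), rfl⟩, ?_⟩
      simp [monomial_mul, add_comm]

lemma mem_span_monomial_image_pow_iff {σ K : Type*} [Field K] {S : Set (σ →₀ ℕ)} (hS : 0 ∉ S)
    (k : ℕ) {p : MvPolynomial σ K} :
    p ∈ Ideal.span ((fun m => monomial m (1 : K)) '' S) ^ k ↔
      ∀ m ∈ p.support, k ≤ order S m := by
  rw [span_monomial_image_pow, mem_ideal_span_monomial_image]
  refine forall₂_congr fun m _ => ?_
  rw [le_order_iff hS]
  constructor
  · rintro ⟨_, ⟨T, hT, hTS, rfl⟩, hm⟩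
    exact ⟨T, hT, hTS, hm⟩
  · rintro ⟨T, hT, hTS, hm⟩
    exact ⟨_, ⟨T, hT, hTS, rfl⟩, hm⟩

lemma exponents_span_monomial_image_pow {σ K : Type*} [Field K] {S : Set (σ →₀ ℕ)} (hS : 0 ∉ S)
    (k : ℕ) : exponents (Ideal.span ((fun m => monomial m (1 : K)) '' S) ^ k) =
      superlevel Set.univ (order S) k := by
  classical
  ext m
  have h : (monomial m (1 : K)).support = {m} := by simp [support_monomial]
  rw [exponents, Set.mem_ofPred_eq, mem_span_monomial_image_pow_iff hS, h]
  simp [superlevel, supportedOn]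

/-! ### Edge ideals of induced subgraphs and bipartite components. -/

/-- The exponent vectors of the generators of the edge ideal of the subgraph induced on `A`. -/
def edgeExponents {V : Type*} (G : SimpleGraph V) (A : Set V) : Set (V →₀ ℕ) :=
  {s | ∃ v ∈ A, ∃ w ∈ A, G.Adj v w ∧ s = Finsupp.single v 1 + Finsupp.single w 1}

lemma zero_notMem_edgeExponents {V : Type*} (G : SimpleGraph V) (A : Set V) :
    0 ∉ edgeExponents G A := by
  rintro ⟨v, -, w, -, -, h⟩
  have := DFunLike.congr_fun h v
  simp only [Finsupp.coe_zero, Pi.zero_apply, Finsupp.add_apply, Finsupp.single_eq_same] at this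
  omega

lemma edgeExponents_subset_supportedOn {V : Type*} (G : SimpleGraph V) (A : Set V) :
    edgeExponents G A ⊆ supportedOn A := by
  rintro _ ⟨v, hv, w, hw, -, rfl⟩ x hx
  have h1 : v ≠ x := by rintro rfl; exact hx hv
  have h2 : w ≠ x := by rintro rfl; exact hx hw
  simp [h1, h2]

lemma edgeIdeal_eq_span {V K : Type*} [Field K] (G : SimpleGraph V) :
    edgeIdeal K G = Ideal.span ((fun m => monomial m (1 : K)) '' edgeExponents G Set.univ) := by
  rw [edgeIdeal]
  congr 1
  ext p
  constructor
  · rintro ⟨v, w, h, rfl⟩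
    exact ⟨_, ⟨v, trivial, w, trivial, h, rfl⟩, by simp [X, monomial_mul]⟩
  · rintro ⟨_, ⟨v, -, w, -, h, rfl⟩, rfl⟩
    exact ⟨v, w, h, by simp [X, monomial_mul]⟩

lemma edgeExponents_union {V : Type*} {G : SimpleGraph V} {A B : Set V}
    (h : ∀ a ∈ A, ∀ b ∈ B, ¬ G.Adj a b) :
    edgeExponents G (A ∪ B) = edgeExponents G A ∪ edgeExponents G B := by
  ext s
  constructor
  · rintro ⟨v, hv | hv, w, hw | hw, hvw, rfl⟩
    · exact Or.inl ⟨v, hv, w, hw, hvw, rfl⟩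
    · exact absurd hvw (h v hv w hw)
    · exact absurd hvw.symm (h w hw v hv)
    · exact Or.inr ⟨v, hv, w, hw, hvw, rfl⟩
  · rintro (⟨v, hv, w, hw, hvw, rfl⟩ | ⟨v, hv, w, hw, hvw, rfl⟩)
    · exact ⟨v, Or.inl hv, w, Or.inl hw, hvw, rfl⟩
    · exact ⟨v, Or.inr hv, w, Or.inr hw, hvw, rfl⟩

lemma order_edgeExponents_union_add {V : Type*} {G : SimpleGraph V} {A B : Set V}
    (hAB : Disjoint A B) (h : ∀ a ∈ A, ∀ b ∈ B, ¬ G.Adj a b) :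
    ∀ a ∈ supportedOn A, ∀ b ∈ supportedOn B, order (edgeExponents G (A ∪ B)) (a + b) =
      order (edgeExponents G A) a + order (edgeExponents G B) b := by
  intro a ha b hb
  rw [edgeExponents_union h]
  exact order_union_add hAB (zero_notMem_edgeExponents G A) (zero_notMem_edgeExponents G B)
    (edgeExponents_subset_supportedOn G A) (edgeExponents_subset_supportedOn G B) ha hb

/-- The powers of the edge ideal of the subgraph induced on `A`, and the quotients of consecutive
powers, have Stanley depth at least `d`. -/
structure PowersHaveDepth {V : Type*} (G : SimpleGraph V) (A : Set V) (d : ℕ) : Prop where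
  level : ∀ j, HasStanleyPartition (level A (order (edgeExponents G A)) j) d
  superlevel : ∀ j, HasStanleyPartition (superlevel A (order (edgeExponents G A)) j) d

lemma powersHaveDepth_zero {V : Type*} [Finite V] (G : SimpleGraph V) (A : Set V) :
    PowersHaveDepth G A 0 :=
  ⟨fun j => hasStanleyPartition_of_ordConnected
    (ordConnected_level A (order_mono (zero_notMem_edgeExponents G A)) j),
  fun j => hasStanleyPartition_of_ordConnected
    (ordConnected_superlevel A (order_mono (zero_notMem_edgeExponents G A)) j)⟩

lemma PowersHaveDepth.union {V : Type*} {G : SimpleGraph V} {A B : Set V} {d e : ℕ}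
    (hA : PowersHaveDepth G A d) (hB : PowersHaveDepth G B e) (hAB : Disjoint A B)
    (h : ∀ a ∈ A, ∀ b ∈ B, ¬ G.Adj a b) : PowersHaveDepth G (A ∪ B) (d + e) :=
  ⟨hasStanleyPartition_level_union hAB (order_edgeExponents_union_add hAB h) hA.level hB.level,
  fun j => hasStanleyPartition_superlevel_union hAB (order_edgeExponents_union_add hAB h) j
    (fun j _ => hA.level j) (hA.superlevel j) fun l _ => hB.superlevel l⟩

lemma powersHaveDepth_one_of_bipartite {V : Type*} [Finite V] {G : SimpleGraph V} {L R : Set V}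
    (hLR : Disjoint L R) (hne : (L ∪ R).Nonempty)
    (h : ∀ v ∈ L ∪ R, ∀ w ∈ L ∪ R, G.Adj v w → v ∈ L ∧ w ∈ R ∨ v ∈ R ∧ w ∈ L) :
    PowersHaveDepth G (L ∪ R) 1 := by
  have h0 := zero_notMem_edgeExponents G (L ∪ R)
  have hS : edgeExponents G (L ∪ R) = {s | ∃ p ∈ {p : V × V | p.1 ∈ L ∧ p.2 ∈ R ∧ G.Adj p.1 p.2},
      s = Finsupp.single p.1 1 + Finsupp.single p.2 1} := by
    ext s
    constructor
    · rintro ⟨v, hv, w, hw, hvw, rfl⟩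
      rcases h v hv w hw hvw with h | h
      · exact ⟨(v, w), ⟨h.1, h.2, hvw⟩, rfl⟩
      · exact ⟨(w, v), ⟨h.2, h.1, hvw.symm⟩, add_comm _ _⟩
    · rintro ⟨⟨v, w⟩, ⟨hv, hw, hvw⟩, rfl⟩
      exact ⟨v, Or.inl hv, w, Or.inr hw, hvw, rfl⟩
  have hdir := exists_order_add_single_eq hLR (fun p hp => ⟨hp.1, hp.2.1⟩) hne h0 hS
  have hsupp : ∀ m ∈ supportedOn (L ∪ R), ∀ v ∈ L ∪ R, ∀ t : ℕ,
      m + Finsupp.single v t ∈ supportedOn (L ∪ R) := by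
    intro m hm v hv t w hw
    have : v ≠ w := by rintro rfl; exact hw hv
    simp [hm w hw, this]
  constructor
  · intro j
    refine hasStanleyPartition_one_of_exists_direction
      (ordConnected_level _ (order_mono h0) j) fun m hm => ?_
    obtain ⟨v, hv, hvt⟩ := hdir m
    exact ⟨v, fun t => ⟨hsupp m hm.1 v hv t, (hvt t).trans hm.2⟩⟩
  · intro j
    refine hasStanleyPartition_one_of_exists_direction
      (ordConnected_superlevel _ (order_mono h0) j) fun m hm => ?_
    obtain ⟨v, hv, hvt⟩ := hdir m
    exact ⟨v, fun t => ⟨hsupp m hm.1 v hv t, hm.2.trans (hvt t).ge⟩⟩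

lemma powersHaveDepth_one_of_isBipartite {V : Type*} [Finite V] {G : SimpleGraph V} {A : Set V}
    (D : (G.induce A).ConnectedComponent) (hD : D.toSimpleGraph.IsBipartite) :
    PowersHaveDepth G (Subtype.val '' D.supp) 1 := by
  obtain ⟨c⟩ := hD
  let L : Set V := {v | ∃ x : D, x.1.1 = v ∧ c x = 0}
  let R : Set V := {v | ∃ x : D, x.1.1 = v ∧ c x = 1}
  have hfin : ∀ x : D, c x = 0 ∨ c x = 1 := fun x => by
    have := (c x).isLt
    rcases Nat.lt_succ_iff_lt_or_eq.1 this with h | h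
    · exact Or.inl (Fin.ext (by simpa using h))
    · exact Or.inr (Fin.ext h)
  have hLR : Subtype.val '' D.supp = L ∪ R := by
    ext v
    constructor
    · rintro ⟨x, hx, rfl⟩
      exact (hfin ⟨x, hx⟩).imp (fun h => ⟨⟨x, hx⟩, rfl, h⟩) fun h => ⟨⟨x, hx⟩, rfl, h⟩
    · rintro (⟨x, rfl, -⟩ | ⟨x, rfl, -⟩) <;> exact ⟨x.1, x.2, rfl⟩
  rw [hLR]
  refine powersHaveDepth_one_of_bipartite ?_ (hLR ▸ D.nonempty_supp.image _) ?_
  · rw [Set.disjoint_left]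
    rintro _ ⟨x, rfl, hx⟩ ⟨y, hxy, hy⟩
    obtain rfl : y = x := Subtype.ext (Subtype.ext hxy)
    rw [hx] at hy
    exact absurd hy (by decide)
  · rw [← hLR]
    rintro _ ⟨v, hv, rfl⟩ _ ⟨w, hw, rfl⟩ hvw
    have hne : c ⟨v, hv⟩ ≠ c ⟨w, hw⟩ := c.valid (show D.toSimpleGraph.Adj ⟨v, hv⟩ ⟨w, hw⟩ from hvw)
    rcases hfin ⟨v, hv⟩ with h | h <;> rcases hfin ⟨w, hw⟩ with h' | h'
    · exact absurd (h.trans h'.symm) hne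
    · exact Or.inl ⟨⟨_, rfl, h⟩, ⟨_, rfl, h'⟩⟩
    · exact Or.inr ⟨⟨_, rfl, h⟩, ⟨_, rfl, h'⟩⟩
    · exact absurd (h.trans h'.symm) hne

/-- Distinct components are disjoint with no edge between them, so depths add: 1 for a bipartite
component, 0 for any other. -/
lemma powersHaveDepth_numBipartiteComponents {V : Type*} [Finite V] (G : SimpleGraph V)
    (A : Set V) : PowersHaveDepth G A (numBipartiteComponents (G.induce A)) := by
  classical
  have := Fintype.ofFinite (G.induce A).ConnectedComponent
  have key : ∀ t : Finset (G.induce A).ConnectedComponent,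
      PowersHaveDepth G (⋃ D ∈ t, Subtype.val '' D.supp)
        (t.filter fun D => D.toSimpleGraph.IsBipartite).card := by
    intro t
    induction t using Finset.induction_on with
    | empty => simpa using powersHaveDepth_zero G ∅
    | insert D t hD ih =>
      rw [Finset.set_biUnion_insert, Finset.filter_insert]
      have h1 : PowersHaveDepth G (Subtype.val '' D.supp)
          (if D.toSimpleGraph.IsBipartite then 1 else 0) := by
        split_ifs with h
        · exact powersHaveDepth_one_of_isBipartite D h
        · exact powersHaveDepth_zero _ _
      have h2 := h1.union ih ?_ ?_
      · convert h2 using 1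
        split_ifs with h
        · rw [Finset.card_insert_of_notMem (by simp [hD]), add_comm]
        · simp
      · rw [Set.disjoint_left]
        rintro _ ⟨v, hv, rfl⟩ hw
        obtain ⟨D', hD', w, hwD, hvw⟩ := Set.mem_iUnion₂.1 hw
        obtain rfl := Subtype.ext hvw
        exact hD ((hv.symm.trans hwD : D = D') ▸ hD')
      · rintro _ ⟨v, hv, rfl⟩ _ hw hadj
        obtain ⟨D', hD', w, hwD, rfl⟩ := Set.mem_iUnion₂.1 hw
        have hadj' : (G.induce A).Adj v w := hadj
        have hw' := D.mem_supp_of_adj_mem_supp hv hadj'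
        exact hD ((hw'.symm.trans hwD : D = D') ▸ hD')
  have hA : (⋃ D ∈ (Finset.univ : Finset (G.induce A).ConnectedComponent),
      Subtype.val '' D.supp) = A := by
    ext v
    simp only [Finset.mem_univ, Set.iUnion_true, Set.mem_iUnion]
    constructor
    · rintro ⟨D, x, -, rfl⟩
      exact x.2
    · exact fun hv => ⟨(G.induce A).connectedComponentMk ⟨v, hv⟩, ⟨v, hv⟩, rfl, rfl⟩
  have := key Finset.univ
  rw [hA] at this
  convert this
  rw [numBipartiteComponents, ← Set.ncard_coe_finset]
  simp

/-! ### Transport along an injection of the variables. -/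

section Transport

variable {V W : Type*} {f : W → V}

lemma mapDomain_le_mapDomain_iff (hf : Function.Injective f) {a b : W →₀ ℕ} :
    a.mapDomain f ≤ b.mapDomain f ↔ a ≤ b := by
  constructor
  · intro h w
    simpa [Finsupp.mapDomain_apply hf] using h (f w)
  · intro h v
    by_cases hv : v ∈ Set.range f
    · obtain ⟨w, rfl⟩ := hv
      simpa [Finsupp.mapDomain_apply hf] using h w
    · simp [Finsupp.mapDomain_of_notMem_range _ _ hv]

lemma exists_mapDomain_eq (hf : Function.Injective f) {m : V →₀ ℕ}
    (hm : m ∈ supportedOn (Set.range f)) : ∃ a : W →₀ ℕ, a.mapDomain f = m := by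
  refine ⟨m.comapDomain f hf.injOn, Finsupp.mapDomain_comapDomain f hf m fun v hv => ?_⟩
  by_contra hv'
  exact (Finsupp.mem_support_iff.1 hv) (hm v hv')

lemma mapDomain_mem_supportedOn (a : W →₀ ℕ) : a.mapDomain f ∈ supportedOn (Set.range f) :=
  fun _ hv => Finsupp.mapDomain_of_notMem_range _ _ hv

lemma mapDomain_mem_box_iff (hf : Function.Injective f) {u a : W →₀ ℕ} {Z : Finset W} :
    a.mapDomain f ∈ box (u.mapDomain f) (Z.map ⟨f, hf⟩) ↔ a ∈ box u Z := by
  simp only [box, Set.mem_ofPred_eq, mapDomain_le_mapDomain_iff hf]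
  refine and_congr_right fun _ => ⟨fun h w hw => ?_, fun h v hv => ?_⟩
  · have := h (f w) (by simpa [hf.eq_iff] using hw)
    simpa [Finsupp.mapDomain_apply hf] using this
  · by_cases hv' : v ∈ Set.range f
    · obtain ⟨w, rfl⟩ := hv'
      simpa [Finsupp.mapDomain_apply hf] using h w (by simpa [hf.eq_iff] using hv)
    · simp [Finsupp.mapDomain_of_notMem_range _ _ hv']

lemma HasStanleyPartition.image_mapDomain (hf : Function.Injective f) {M : Set (W →₀ ℕ)} {d : ℕ}
    (h : HasStanleyPartition M d) : HasStanleyPartition (Finsupp.mapDomain f '' M) d := by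
  obtain ⟨r, u, Z, h, hd⟩ := h
  refine ⟨r, fun i => (u i).mapDomain f, fun i => (Z i).map ⟨f, hf⟩, ⟨fun i m hm => ?_, ?_⟩,
    fun i => by simpa using hd i⟩
  · obtain ⟨a, rfl⟩ := exists_mapDomain_eq hf (m := m) fun v hv => by
      rw [hm.2 v (by rw [Finset.mem_map]; rintro ⟨w, -, rfl⟩; exact hv ⟨w, rfl⟩)]
      exact mapDomain_mem_supportedOn _ v hv
    exact ⟨a, h.subset i ((mapDomain_mem_box_iff hf).1 hm), rfl⟩
  · rintro _ ⟨a, ha, rfl⟩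
    simp only [mapDomain_mem_box_iff hf]
    exact h.existsUnique a ha

lemma order_image_mapDomain (hf : Function.Injective f) (S : Set (W →₀ ℕ)) (a : W →₀ ℕ) :
    order (Finsupp.mapDomain f '' S) (a.mapDomain f) = order S a := by
  have hsum : ∀ T : Multiset (W →₀ ℕ), (T.map (Finsupp.mapDomain f)).sum = T.sum.mapDomain f :=
    fun T => ((Finsupp.mapDomain.addMonoidHom f).map_multiset_sum T).symm
  unfold order
  congr 1
  ext k
  constructor
  · rintro ⟨T, hT, hTS, hTa⟩
    choose! g hg hgf using hTS
    have hmap : (T.map g).map (Finsupp.mapDomain f) = T := by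
      rw [Multiset.map_map]
      exact (Multiset.map_congr rfl fun s hs => hgf s hs).trans (Multiset.map_id' T)
    refine ⟨T.map g, by simpa using hT, ?_, ?_⟩
    · intro s hs
      obtain ⟨t, ht, rfl⟩ := Multiset.mem_map.1 hs
      exact hg t ht
    · rwa [← hmap, hsum, mapDomain_le_mapDomain_iff hf] at hTa
  · rintro ⟨T, hT, hTS, hTa⟩
    refine ⟨T.map (Finsupp.mapDomain f), by simpa using hT, ?_, ?_⟩
    · intro s hs
      obtain ⟨t, ht, rfl⟩ := Multiset.mem_map.1 hs
      exact ⟨t, hTS t ht, rfl⟩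
    · rwa [hsum, mapDomain_le_mapDomain_iff hf]

lemma superlevel_range_eq_image (hf : Function.Injective f) {F : SimpleGraph W}
    {G : SimpleGraph V} (hFG : ∀ a b, F.Adj a b ↔ G.Adj (f a) (f b)) (l : ℕ) :
    superlevel (Set.range f) (order (edgeExponents G (Set.range f))) l =
      Finsupp.mapDomain f '' superlevel Set.univ (order (edgeExponents F Set.univ)) l := by
  have hS : edgeExponents G (Set.range f) =
      Finsupp.mapDomain f '' edgeExponents F Set.univ := by
    ext s
    constructor
    · rintro ⟨_, ⟨a, rfl⟩, _, ⟨b, rfl⟩, hab, rfl⟩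
      exact ⟨_, ⟨a, trivial, b, trivial, (hFG a b).2 hab, rfl⟩,
        by simp [Finsupp.mapDomain_add, Finsupp.mapDomain_single]⟩
    · rintro ⟨_, ⟨a, -, b, -, hab, rfl⟩, rfl⟩
      exact ⟨_, ⟨a, rfl⟩, _, ⟨b, rfl⟩, (hFG a b).1 hab,
        by simp [Finsupp.mapDomain_add, Finsupp.mapDomain_single]⟩
  rw [hS]
  ext m
  constructor
  · rintro ⟨hm, hml⟩
    obtain ⟨a, rfl⟩ := exists_mapDomain_eq hf hm
    rw [order_image_mapDomain hf] at hml
    exact ⟨a, ⟨fun v hv => absurd trivial hv, hml⟩, rfl⟩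
  · rintro ⟨a, ⟨-, ha⟩, rfl⟩
    exact ⟨mapDomain_mem_supportedOn a, (order_image_mapDomain hf _ a).symm ▸ ha⟩

end Transport

/-! ### Assembly of the lower bound. -/

lemma hasStanleyPartition_univ {V : Type*} [Fintype V] :
    HasStanleyPartition (Set.univ : Set (V →₀ ℕ)) (Fintype.card V) := by
  refine IsStanleyPartition.hasStanleyPartition (ι := Unit) (u := fun _ => 0)
    (Z := fun _ => Finset.univ) ⟨fun _ => Set.subset_univ _, fun m _ => ?_⟩ fun _ => le_rfl
  exact ⟨(), ⟨zero_le, fun v hv => absurd (Finset.mem_univ v) hv⟩, fun _ _ => rfl⟩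

lemma add_numBipartiteComponents_le_idealSdepth {V K : Type*} [Finite V] [Field K]
    (G : SimpleGraph V) (H : G.ConnectedComponent) (hH : H.toSimpleGraph.edgeSet.Nonempty) (k : ℕ)
    (hk : 1 ≤ k) (d : ℕ)
    (hd : ∀ l ∈ Finset.Icc 1 k, (d : ℕ∞) ≤ idealSdepth (edgeIdeal K H.toSimpleGraph ^ l)) :
    ((d + numBipartiteComponents (G.induce H.suppᶜ) : ℕ) : ℕ∞) ≤
      idealSdepth (edgeIdeal K G ^ k) := by
  classical
  have := Fintype.ofFinite H
  let F := H.toSimpleGraph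
  have hSF := zero_notMem_edgeExponents F Set.univ
  have hpart : ∀ l, 1 ≤ l → l ≤ k →
      HasStanleyPartition (superlevel Set.univ (order (edgeExponents F Set.univ)) l) d := by
    intro l hl hlk
    have := hasStanleyPartition_of_le_idealSdepth (hd l (Finset.mem_Icc.2 ⟨hl, hlk⟩))
    rwa [edgeIdeal_eq_span, exponents_span_monomial_image_pow hSF] at this
  -- An edge makes the first power nonzero, so its partition has a box, of dimension at most the
  -- number of variables.
  have hcard : d ≤ Fintype.card H := by
    obtain ⟨e, he⟩ := hH
    induction e with
    | _ v w =>
      have hvw : F.Adj v w := he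
      obtain ⟨Z, hZ⟩ := (hpart 1 le_rfl hk).le_card
        ⟨Finsupp.single v 1 + Finsupp.single w 1, fun v hv => absurd trivial hv, by
          rw [le_order_iff hSF]
          exact ⟨{Finsupp.single v 1 + Finsupp.single w 1}, by simp, by
            simpa using ⟨v, trivial, w, trivial, hvw, rfl⟩, by simp⟩⟩
      exact hZ.trans (Finset.card_le_univ Z)
  -- The exponent `l = 0`, absent from the minimum, is needed for the piece of order at least `k`
  -- outside `H`. There the whole ring is one box, of dimension at least `d` by `hcard`.
  have hpart' : ∀ l ≤ k,
      HasStanleyPartition (superlevel Set.univ (order (edgeExponents F Set.univ)) l) d := by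
    intro l hl
    rcases Nat.eq_zero_or_pos l with rfl | hl0
    · convert hasStanleyPartition_univ.mono hcard using 1
      exact Set.eq_univ_of_forall fun m => ⟨fun v hv => absurd trivial hv, Nat.zero_le _⟩
    · exact hpart l hl0 hl
  have hrange : Set.range (Subtype.val : H → V) = H.supp := Subtype.range_coe
  have hpartH : ∀ l ≤ k,
      HasStanleyPartition (superlevel H.supp (order (edgeExponents G H.supp)) l) d := by
    intro l hl
    have := (hpart' l hl).image_mapDomain (Subtype.val_injective (p := (· ∈ H)))
    rwa [← superlevel_range_eq_image (G := G) Subtype.val_injective fun a b => Iff.rfl,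
      hrange] at this
  have hC := powersHaveDepth_numBipartiteComponents G H.suppᶜ
  have hno : ∀ a ∈ H.suppᶜ, ∀ b ∈ H.supp, ¬ G.Adj a b := fun a ha b hb hab =>
    ha (H.mem_supp_of_adj_mem_supp hb hab.symm)
  have hS := zero_notMem_edgeExponents G Set.univ
  have hG := hasStanleyPartition_superlevel_union disjoint_compl_left
    (order_edgeExponents_union_add disjoint_compl_left hno) k (fun j _ => hC.level j)
    (hC.superlevel k) hpartH
  rw [Set.compl_union_self] at hG
  rw [add_comm]
  refine le_idealSdepth_of_hasStanleyPartition ?_ ?_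
  · intro p hp m hm
    rw [edgeIdeal_eq_span] at hp ⊢
    rw [exponents_span_monomial_image_pow hS]
    exact ⟨fun v hv => absurd trivial hv, (mem_span_monomial_image_pow_iff hS k).1 hp m hm⟩
  · rwa [edgeIdeal_eq_span, exponents_span_monomial_image_pow hS]

end StanleyDepth

theorem theorem3p1 {V K : Type*} [Finite V] [Field K] (G : SimpleGraph V)
    (H : G.ConnectedComponent) (hH : H.toSimpleGraph.edgeSet.Nonempty) (k : ℕ) (hk : 1 ≤ k) :
    (⨅ l ∈ Finset.Icc 1 k,
        StanleyDepth.idealSdepth (StanleyDepth.edgeIdeal K H.toSimpleGraph ^ l)) +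
      (StanleyDepth.numBipartiteComponents (G.induce H.suppᶜ) : ℕ∞) ≤
    StanleyDepth.idealSdepth (StanleyDepth.edgeIdeal K G ^ k) := by
  have key := StanleyDepth.add_numBipartiteComponents_le_idealSdepth (K := K) G H hH k hk
  set x := ⨅ l ∈ Finset.Icc 1 k,
    StanleyDepth.idealSdepth (StanleyDepth.edgeIdeal K H.toSimpleGraph ^ l) with hx
  have hle : ∀ l ∈ Finset.Icc 1 k,
      x ≤ StanleyDepth.idealSdepth (StanleyDepth.edgeIdeal K H.toSimpleGraph ^ l) :=
    fun l hl => iInf₂_le l hl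
  clear_value x
  induction x using ENat.recTopCoe with
  | top =>
    -- An infinite minimum admits every natural number as `d`, so the right-hand side exceeds every
    -- bound.
    refine le_trans le_top (ENat.forall_natCast_le_iff_le.1 fun n _ => ?_)
    exact le_trans (by exact_mod_cast Nat.le_add_right n _)
      (key n fun l hl => le_top.trans (hle l hl))
  | coe d => exact_mod_cast key d hle
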